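/- Let $\mathbf{k}$ be a field, $Z$ a well-ordered set, $\mathcal{S}(Z)$ (resp. $\mathcal{M}(Z)=\mathcal{S}(Z)\sqcup\{1\}$) the free semigroup (resp. free monoid) on $Z$, and $\mathbf{k}\mathcal{S}(Z)$ the free nonunital associative algebra. Order $\mathcal{S}(Z)$ by the degree lexicographic order and write $\bar g$ for the leading monomial of a nonzero $g$. Let $G\subset\mathbf{k}\mathcal{S}(Z)$ be a finite Gröbner–Shirshov basis with respect to this order (all intersection and inclusion compositions of monicized elements of $G$ are trivial), let $I_A$ be the two-sided ideal generated by $G$, and let $A=\mathbf{k}\mathcal{S}(Z)/I_A$. Put $\mathrm{Irr}(G)=\mathcal{S}(Z)\setminus\{u\bar g v\mid 0\neq g\in G,\ u,v\in\mathcal{M}(Z)\}$. An operated algebra is a nonunital associative $\mathbf{k}$-algebra with a linear operator $P=\lfloor\ \rfloor$. Fix $\lambda\in\mathbf{k}$; a $\phi_4$-algebra is an operated algebra in which $\phi_4(a,b):=\lfloor ab\rfloor-\lambda ab=0$ for all $a,b$. Let $\mathfrak{S}(Z)$ be the free operated semigroup on $Z$, i.e. the set of nonempty bracketed words (nonempty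 words in the alphabet $Z\sqcup\lfloor\mathfrak{S}(Z)\rfloor$), let $S_{\phi_4}(\mathfrak{S}(Z))=\{\phi_4(u,v)\mid u,v\in\mathfrak{S}(Z)\}$, and let $$\mathcal{F}(A)=\mathbf{k}\mathfrak{S}(Z)/\langle S_{\phi_4}(\mathfrak{S}(Z))\cup I_A\rangle,$$ the quotient by the operated ideal generated by $S_{\phi_4}(\mathfrak{S}(Z))\cup I_A$. With the induced operator and the canonical map $A\to\mathcal{F}(A)$, this is the free $\phi_4$-algebra over $A$: every algebra homomorphism from $A$ to a $\phi_4$-algebra extends uniquely to a homomorphism of operated algebras on $\mathcal{F}(A)$. Let $\pi(g)\in\mathbf{k}Z$ be the linear part of $g$, and let $G^{(1)}$ be the linearly self-reduced basis of the span $\mathbf{k}\pi(G)\subset\mathbf{k}Z$ of $\{\pi(g)\mid g\in G\}$; that is, each $s\in G^{(1)}$ has leading coefficient $1$ and no basis element occurring in $s$ is the leading basis element of an element of $G^{(1)}\setminus\{s\}$. Such a basis exists and is unique. Then the (classes of the) words in the union of $\mathrm{Irr}(G)$ with $$\bigcup_{r\ge1}\left\{u_0\lfloor v_1\rfloor^{(k_1)}u_1\cdots\lfloor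 v_r\rfloor^{(k_r)}u_r\ \middle|\ u_i\in\mathrm{Irr}(G)\cup\{1\}\ (0\le i\le r),\ v_j\in Z\setminus\{\bar g\mid g\in G^{(1)}\},\ k_j\ge1\ (1\le j\le r)\right\}$$ form a linear basis of $\mathcal{F}(A)$ over $\mathbf{k}$, where $\lfloor v\rfloor^{(1)}=\lfloor v\rfloor$ and $\lfloor v\rfloor^{(k+1)}=\lfloor\lfloor v\rfloor^{(k)}\rfloor$. -/

import Mathlib

universe u v w

namespace PhiFour

noncomputable section

/-! ## Ideals and quotients of nonunital associative algebras -/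

/-- A two-sided ideal of a nonunital `k`-algebra `R`: a subspace absorbing multiplication
on both sides. -/
structure AlgIdeal (k : Type u) (R : Type v) [Field k] [NonUnitalRing R] [Module k R]
    extends Submodule k R where
  mul_mem_left' : ∀ a x : R, x ∈ carrier → a * x ∈ carrier
  mul_mem_right' : ∀ a x : R, x ∈ carrier → x * a ∈ carrier

/-- The two-sided ideal generated by a set: the intersection of all ideals containing it. -/
def AlgIdeal.span (k : Type u) {R : Type v} [Field k] [NonUnitalRing R] [Module k R]
    (S : Set R) : AlgIdeal k R where
  carrier := {x | ∀ J : AlgIdeal k R, S ⊆ J.carrier → x ∈ J.carrier}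
  add_mem' := fun ha hb J hJ => J.add_mem' (ha J hJ) (hb J hJ)
  zero_mem' := fun J _ => J.zero_mem'
  smul_mem' := fun c _ hx J hJ => J.smul_mem' c (hx J hJ)
  mul_mem_left' := fun a x hx J hJ => J.mul_mem_left' a x (hx J hJ)
  mul_mem_right' := fun a x hx J hJ => J.mul_mem_right' a x (hx J hJ)

section Quotient

variable {k : Type u} {R : Type v} [Field k] [NonUnitalRing R] [Module k R]

/-- The quotient algebra `R / I`. -/
def AlgIdeal.Quot (I : AlgIdeal k R) : Type v := R ⧸ I.toSubmodule

instance (I : AlgIdeal k R) : AddCommGroup I.Quot :=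
  inferInstanceAs (AddCommGroup (R ⧸ I.toSubmodule))

instance (I : AlgIdeal k R) : Module k I.Quot :=
  inferInstanceAs (Module k (R ⧸ I.toSubmodule))

/-- The class of an element in the quotient, as a linear map. -/
def AlgIdeal.mkL (I : AlgIdeal k R) : R →ₗ[k] I.Quot := I.toSubmodule.mkQ

theorem AlgIdeal.mkL_surjective (I : AlgIdeal k R) : Function.Surjective I.mkL :=
  I.toSubmodule.mkQ_surjective

instance (I : AlgIdeal k R) : Mul I.Quot :=
  ⟨Quotient.map₂ (· * ·) (by
    intro a b hab c d hcd
    have h1 : a - b ∈ I.toSubmodule := (Submodule.quotientRel_def _).1 hab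
    have h2 : c - d ∈ I.toSubmodule := (Submodule.quotientRel_def _).1 hcd
    refine (Submodule.quotientRel_def _).2 ?_
    have h : a * c - b * d = (a - b) * c + b * (c - d) := by
      rw [sub_mul, mul_sub]; abel
    change a * c - b * d ∈ I.toSubmodule
    rw [h]
    exact I.toSubmodule.add_mem (I.mul_mem_right' c _ h1) (I.mul_mem_left' b _ h2))⟩

theorem AlgIdeal.mkL_mul (I : AlgIdeal k R) (a b : R) :
    I.mkL (a * b) = I.mkL a * I.mkL b := rfl

instance (I : AlgIdeal k R) : NonUnitalRing I.Quot :=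
  { (inferInstance : AddCommGroup I.Quot), (inferInstance : Mul I.Quot) with
    left_distrib := by
      intro a b c
      obtain ⟨a, rfl⟩ := I.mkL_surjective a
      obtain ⟨b, rfl⟩ := I.mkL_surjective b
      obtain ⟨c, rfl⟩ := I.mkL_surjective c
      change I.mkL a * (I.mkL b + I.mkL c) = I.mkL a * I.mkL b + I.mkL a * I.mkL c
      rw [← map_add, ← I.mkL_mul, ← I.mkL_mul, ← I.mkL_mul, ← map_add, mul_add]
    right_distrib := by
      intro a b c
      obtain ⟨a, rfl⟩ := I.mkL_surjective a
      obtain ⟨b, rfl⟩ := I.mkL_surjective b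
      obtain ⟨c, rfl⟩ := I.mkL_surjective c
      change (I.mkL a + I.mkL b) * I.mkL c = I.mkL a * I.mkL c + I.mkL b * I.mkL c
      rw [← map_add, ← I.mkL_mul, ← I.mkL_mul, ← I.mkL_mul, ← map_add, add_mul]
    zero_mul := by
      intro a
      obtain ⟨a, rfl⟩ := I.mkL_surjective a
      change (0 : I.Quot) * I.mkL a = 0
      rw [← map_zero I.mkL, ← I.mkL_mul, zero_mul]
    mul_zero := by
      intro a
      obtain ⟨a, rfl⟩ := I.mkL_surjective a
      change I.mkL a * (0 : I.Quot) = 0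
      rw [← map_zero I.mkL, ← I.mkL_mul, mul_zero]
    mul_assoc := by
      intro a b c
      obtain ⟨a, rfl⟩ := I.mkL_surjective a
      obtain ⟨b, rfl⟩ := I.mkL_surjective b
      obtain ⟨c, rfl⟩ := I.mkL_surjective c
      rw [← I.mkL_mul, ← I.mkL_mul, ← I.mkL_mul, ← I.mkL_mul, mul_assoc] }

instance [IsScalarTower k R R] (I : AlgIdeal k R) : IsScalarTower k I.Quot I.Quot :=
  ⟨by
    intro c a b
    obtain ⟨a, rfl⟩ := I.mkL_surjective a
    obtain ⟨b, rfl⟩ := I.mkL_surjective b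
    rw [smul_eq_mul, smul_eq_mul, ← map_smul, ← I.mkL_mul, ← I.mkL_mul, ← map_smul,
      smul_mul_assoc]⟩

instance [SMulCommClass k R R] (I : AlgIdeal k R) : SMulCommClass k I.Quot I.Quot :=
  ⟨by
    intro c a b
    obtain ⟨a, rfl⟩ := I.mkL_surjective a
    obtain ⟨b, rfl⟩ := I.mkL_surjective b
    rw [smul_eq_mul, smul_eq_mul, ← map_smul, ← I.mkL_mul, ← I.mkL_mul, ← map_smul,
      mul_smul_comm]⟩

/-- A homomorphism of algebras carrying `I` into `J` induces a homomorphism `R / I → R' / J`. -/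
def AlgIdeal.mapQ {R' : Type w} [NonUnitalRing R'] [Module k R'] (I : AlgIdeal k R)
    (J : AlgIdeal k R') (f : R →ₙₐ[k] R') (h : ∀ x ∈ I.toSubmodule, f x ∈ J.toSubmodule) :
    I.Quot →ₙₐ[k] J.Quot :=
  let L : I.Quot →ₗ[k] J.Quot := Submodule.mapQ I.toSubmodule J.toSubmodule (f : R →ₗ[k] R') h
  { toFun := L
    map_smul' := fun c x => map_smul L c x
    map_zero' := map_zero L
    map_add' := map_add L
    map_mul' := by
      intro a b
      obtain ⟨a, rfl⟩ := I.mkL_surjective a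
      obtain ⟨b, rfl⟩ := I.mkL_surjective b
      change J.mkL (f (a * b)) = J.mkL (f a) * J.mkL (f b)
      rw [map_mul, J.mkL_mul] }

end Quotient

/-! ## Operated algebras, the identity `⌊xy⌋ - λ xy`, and free algebras over an algebra

An operated algebra is a nonunital associative algebra `R` with a linear operator `P`. -/

/-- An operated ideal: a two-sided ideal closed under the operator `P`. -/
structure OpIdeal (k : Type u) {R : Type v} [Field k] [NonUnitalRing R] [Module k R]
    (P : R →ₗ[k] R) extends AlgIdeal k R where
  op_mem' : ∀ x : R, x ∈ carrier → P x ∈ carrier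

/-- The operated ideal generated by a set: the intersection of all operated ideals
containing it. -/
def OpIdeal.span {k : Type u} {R : Type v} [Field k] [NonUnitalRing R] [Module k R]
    (P : R →ₗ[k] R) (S : Set R) : OpIdeal k P where
  carrier := {x | ∀ J : OpIdeal k P, S ⊆ J.carrier → x ∈ J.carrier}
  add_mem' := fun ha hb J hJ => J.add_mem' (ha J hJ) (hb J hJ)
  zero_mem' := fun J _ => J.zero_mem'
  smul_mem' := fun c _ hx J hJ => J.smul_mem' c (hx J hJ)
  mul_mem_left' := fun a x hx J hJ => J.mul_mem_left' a x (hx J hJ)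
  mul_mem_right' := fun a x hx J hJ => J.mul_mem_right' a x (hx J hJ)
  op_mem' := fun x hx J hJ => J.op_mem' x (hx J hJ)

theorem OpIdeal.subset_span {k : Type u} {R : Type v} [Field k] [NonUnitalRing R] [Module k R]
    (P : R →ₗ[k] R) (S : Set R) : S ⊆ (OpIdeal.span P S).carrier :=
  fun _ hx _ hJ => hJ hx

/-- The operator induced on the quotient by an operated ideal. -/
def OpIdeal.quotOp {k : Type u} {R : Type v} [Field k] [NonUnitalRing R] [Module k R]
    {P : R →ₗ[k] R} (I : OpIdeal k P) : I.toAlgIdeal.Quot →ₗ[k] I.toAlgIdeal.Quot :=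
  Submodule.mapQ I.toSubmodule I.toSubmodule P (fun x hx => I.op_mem' x hx)

/-- The value `φ₄(a, b) = ⌊ab⌋ - λ ab` in an operated algebra with operator `P = ⌊ ⌋`. -/
def phi4 {k : Type u} {R : Type v} [Field k] [NonUnitalRing R] [Module k R]
    (lam : k) (P : R →ₗ[k] R) (a b : R) : R :=
  P (a * b) - lam • (a * b)

/-- `(R, P)` is a `φ₄`-algebra: `φ₄` vanishes identically on `R`. -/
def IsPhi4Algebra {k : Type u} {R : Type v} [Field k] [NonUnitalRing R] [Module k R]
    (lam : k) (P : R →ₗ[k] R) : Prop :=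
  ∀ a b : R, phi4 lam P a b = 0

/-- `(F, P)` with `i : A → F` is the free `φ₄`-algebra over the algebra `A`: it is a
`φ₄`-algebra, and every algebra homomorphism from `A` to a `φ₄`-algebra `(B, Q)` factors
through `i` by a unique homomorphism of operated algebras. (The target `B` ranges over the
universe `w`, which is arbitrary.) -/
def IsFreePhi4Over.{w', u', v₁, v₂} {k : Type u'} [Field k] {A : Type v₁} {F : Type v₂}
    [NonUnitalRing A] [Module k A] [NonUnitalRing F] [Module k F]
    (lam : k) (P : F →ₗ[k] F) (i : A →ₙₐ[k] F) : Prop :=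
  IsPhi4Algebra lam P ∧
  ∀ (B : Type w') [NonUnitalRing B] [Module k B] [IsScalarTower k B B] [SMulCommClass k B B]
    (Q : B →ₗ[k] B), IsPhi4Algebra lam Q → ∀ f : A →ₙₐ[k] B,
      ∃! g : F →ₙₐ[k] B, (∀ x, g (P x) = Q (g x)) ∧ ∀ a, g (i a) = f a

/-! ## Leading basis elements and linearly self-reduced bases -/

/-- `b` is the leading basis element of the vector `f = ∑ f(b) b`, with respect to a strict
linear order `lt` on the chosen basis `ι`. No basis element is leading in `0`. -/
def IsLeading {ι : Type u} {k : Type v} [Field k] (lt : ι → ι → Prop) (f : ι →₀ k) (b : ι) :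
    Prop :=
  f b ≠ 0 ∧ ∀ c, f c ≠ 0 → c ≠ b → lt c b

/-- `f` is linearly reduced with respect to `S`: no basis element occurring in `f` is the
leading basis element of an element of `S`. -/
def LinearlyReduced {ι : Type u} {k : Type v} [Field k] (lt : ι → ι → Prop)
    (S : Set (ι →₀ k)) (f : ι →₀ k) : Prop :=
  ∀ b, f b ≠ 0 → ∀ s ∈ S, ¬ IsLeading lt s b

/-- Each `s ∈ S` has leading coefficient `1` and is linearly reduced with respect to
`S \ {s}`. -/
def LinearlySelfReduced {ι : Type u} {k : Type v} [Field k] (lt : ι → ι → Prop)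
    (S : Set (ι →₀ k)) : Prop :=
  ∀ s ∈ S, (∃ b, IsLeading lt s b ∧ s b = 1) ∧ LinearlyReduced lt (S \ {s}) s

/-- `S` is a linearly self-reduced basis of the subspace `W`. -/
def IsSelfReducedBasis {ι : Type u} {k : Type v} [Field k] (lt : ι → ι → Prop)
    (S : Set (ι →₀ k)) (W : Submodule k (ι →₀ k)) : Prop :=
  LinearlySelfReduced lt S ∧ LinearIndepOn k id S ∧ Submodule.span k S = W

/-! ## Words

`FreeSemigroup X` is the free semigroup on `X`, and `FreeMonoid X` the free monoid. -/

/-- The inclusion of the free semigroup into the free monoid. -/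
def toMonoid {X : Type u} (w : FreeSemigroup X) : FreeMonoid X :=
  FreeMonoid.ofList (w.head :: w.tail)

/-- The word `p w q`, for a nonempty word `w` and possibly empty words `p` and `q`. -/
def sandwich {X : Type u} (p : FreeMonoid X) (w : FreeSemigroup X) (q : FreeMonoid X) :
    FreeSemigroup X :=
  match FreeMonoid.toList p with
  | [] => ⟨w.head, w.tail ++ FreeMonoid.toList q⟩
  | a :: p' => ⟨a, p' ++ w.head :: (w.tail ++ FreeMonoid.toList q)⟩

theorem toMonoid_sandwich {X : Type u} (p : FreeMonoid X) (w : FreeSemigroup X)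
    (q : FreeMonoid X) : toMonoid (sandwich p w q) = p * toMonoid w * q := by
  apply FreeMonoid.toList.injective
  unfold sandwich toMonoid
  split <;> simp_all [FreeMonoid.toList_mul]

/-- The strict degree lexicographic order on nonempty words: first compare the lengths, then
compare lexicographically. -/
def dlexLT {Z : Type u} [LinearOrder Z] (a b : FreeSemigroup Z) : Prop :=
  List.Shortlex (· < ·) (a.head :: a.tail) (b.head :: b.tail)

/-! ## Gröbner–Shirshov bases in `k S(Z)` with respect to the degree lexicographic order -/

section GS

variable {k : Type u} {Z : Type v} [Field k] [LinearOrder Z]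

/-- `m` is the leading monomial of `f`. -/
def IsLM (f : MonoidAlgebra k (FreeSemigroup Z)) (m : FreeSemigroup Z) : Prop :=
  IsLeading dlexLT f.coeff m

/-- The polynomial `p f q`, for possibly empty words `p` and `q`. -/
def sandwichPoly (p : FreeMonoid Z) (f : MonoidAlgebra k (FreeSemigroup Z)) (q : FreeMonoid Z) :
    MonoidAlgebra k (FreeSemigroup Z) :=
  MonoidAlgebra.mapDomain (fun w => sandwich p w q) f

/-- `f` is trivial modulo `(G, w)`: it is a linear combination of polynomials `p s q` with
`s ∈ G` and `p s̄ q < w`, where `s̄` is the leading monomial of `s`. -/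
def TrivialMod (G : Set (MonoidAlgebra k (FreeSemigroup Z))) (w : FreeSemigroup Z)
    (f : MonoidAlgebra k (FreeSemigroup Z)) : Prop :=
  f ∈ Submodule.span k {h | ∃ s ∈ G, ∃ m, IsLM s m ∧ ∃ p q : FreeMonoid Z,
    dlexLT (sandwich p m q) w ∧ h = sandwichPoly p s q}

/-- `f` divided by its coefficient at `m`; used when `m` is the leading monomial of `f`. -/
def monicize (f : MonoidAlgebra k (FreeSemigroup Z)) (m : FreeSemigroup Z) :
    MonoidAlgebra k (FreeSemigroup Z) :=
  (f.coeff m)⁻¹ • f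

/-- `G` is a Gröbner–Shirshov basis: all intersection compositions and all inclusion
compositions of (monicized, nonzero) elements of `G` are trivial. -/
def IsGSBasis (G : Set (MonoidAlgebra k (FreeSemigroup Z))) : Prop :=
  ∀ f ∈ G, ∀ g ∈ G, ∀ mf mg : FreeSemigroup Z, IsLM f mf → IsLM g mg →
    (∀ a b : FreeSemigroup Z, mf * a = b * mg →
      max mf.length mg.length < (mf * a).length →
      (mf * a).length < mf.length + mg.length →
      TrivialMod G (mf * a)
        (monicize f mf * MonoidAlgebra.single a 1 - MonoidAlgebra.single b 1 * monicize g mg)) ∧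
    (∀ p q : FreeMonoid Z, mf = sandwich p mg q →
      TrivialMod G mf (monicize f mf - sandwichPoly p (monicize g mg) q))

/-- `Irr(G)`: the nonempty words that contain no leading monomial of an element of `G` as a
subword. -/
def Irr (G : Set (MonoidAlgebra k (FreeSemigroup Z))) : Set (FreeSemigroup Z) :=
  {w | ∀ g ∈ G, ∀ m, IsLM g m → ∀ p q : FreeMonoid Z, w ≠ sandwich p m q}

/-- `Irr(G) ∪ {1}`, as a set of possibly empty words. -/
def IrrOne (G : Set (MonoidAlgebra k (FreeSemigroup Z))) : Set (FreeMonoid Z) :=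
  toMonoid '' Irr G ∪ {1}

/-- The linear part `π(g) ∈ k Z` of a polynomial `g`: its component on words of length one. -/
def linearPart (g : MonoidAlgebra k (FreeSemigroup Z)) : Z →₀ k :=
  Finsupp.comapDomain FreeSemigroup.of g.coeff
    (fun _ _ _ _ h => congrArg FreeSemigroup.head h)

/-- The subspace `k π(G)` of `k Z` spanned by the linear parts of the elements of `G`. -/
def linearPartSpan (G : Set (MonoidAlgebra k (FreeSemigroup Z))) : Submodule k (Z →₀ k) :=
  Submodule.span k (linearPart '' G)

end GS

/-! ## The free operated semigroup and the free operated algebra -/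

/-- The letters of bracketed words over `Z`: the elements of `Z`, and a letter `⌊w⌋` for every
nonempty word `w` in such letters. -/
inductive OpLetter (Z : Type u) : Type u
  | var : Z → OpLetter Z
  | br : FreeSemigroup (OpLetter Z) → OpLetter Z

/-- The free operated semigroup `𝔖(Z)`: nonempty words in the alphabet `Z ⊔ ⌊𝔖(Z)⌋`. -/
abbrev OpWord (Z : Type u) : Type u := FreeSemigroup (OpLetter Z)

/-- The operator `w ↦ ⌊w⌋` of `𝔖(Z)`. -/
def OpWord.bracket {Z : Type u} (w : OpWord Z) : OpWord Z := FreeSemigroup.of (OpLetter.br w)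

/-- A letter `z ∈ Z` as an element of `𝔖(Z)`. -/
def OpWord.ofVar {Z : Type u} (z : Z) : OpWord Z := FreeSemigroup.of (OpLetter.var z)

/-- The operator of the free operated algebra `k 𝔖(Z)`: the linear extension of `w ↦ ⌊w⌋`. -/
def bracketL (k : Type u) (Z : Type v) [Field k] :
    MonoidAlgebra k (OpWord Z) →ₗ[k] MonoidAlgebra k (OpWord Z) :=
  MonoidAlgebra.mapDomainLinearMap k k OpWord.bracket

/-- The inclusion `k S(Z) → k 𝔖(Z)`. -/
def inclHom (k : Type u) (Z : Type v) [Field k] :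
    MonoidAlgebra k (FreeSemigroup Z) →ₙₐ[k] MonoidAlgebra k (OpWord Z) :=
  MonoidAlgebra.mapDomainNonUnitalAlgHom k k (FreeSemigroup.map OpLetter.var)

/-- The set `S_{φ₄}(𝔖(Z)) = {⌊uv⌋ - λ uv | u, v ∈ 𝔖(Z)}`. -/
def phi4Set {k : Type u} [Field k] (lam : k) (Z : Type v) : Set (MonoidAlgebra k (OpWord Z)) :=
  {x | ∃ a b : OpWord Z, x = phi4 lam (bracketL k Z)
    (MonoidAlgebra.single a 1) (MonoidAlgebra.single b 1)}

/-- The operated ideal `⟨S_{φ₄}(𝔖(Z)) ∪ I⟩` of `k 𝔖(Z)`. -/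
def freeIdeal {k : Type u} {Z : Type v} [Field k] (lam : k)
    (I : AlgIdeal k (MonoidAlgebra k (FreeSemigroup Z))) : OpIdeal k (bracketL k Z) :=
  OpIdeal.span (bracketL k Z) (phi4Set lam Z ∪ inclHom k Z '' I.carrier)

/-- `k 𝔖(Z) / ⟨S_{φ₄}(𝔖(Z)) ∪ I⟩`, the free `φ₄`-algebra over `A = k S(Z) / I`. -/
abbrev FreePhi4 {k : Type u} {Z : Type v} [Field k] (lam : k)
    (I : AlgIdeal k (MonoidAlgebra k (FreeSemigroup Z))) : Type (max u v) :=
  (freeIdeal lam I).toAlgIdeal.Quot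

/-- The operator of `FreePhi4 lam I`. -/
def FreePhi4.op {k : Type u} {Z : Type v} [Field k] (lam : k)
    (I : AlgIdeal k (MonoidAlgebra k (FreeSemigroup Z))) :
    FreePhi4 lam I →ₗ[k] FreePhi4 lam I :=
  (freeIdeal lam I).quotOp

/-- The canonical homomorphism from `A = k S(Z) / I` to `FreePhi4 lam I`. -/
def FreePhi4.incl {k : Type u} {Z : Type v} [Field k] (lam : k)
    (I : AlgIdeal k (MonoidAlgebra k (FreeSemigroup Z))) :
    I.Quot →ₙₐ[k] FreePhi4 lam I :=
  AlgIdeal.mapQ I (freeIdeal lam I).toAlgIdeal (inclHom k Z)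
    (fun x hx => OpIdeal.subset_span _ _ (Or.inr ⟨x, hx, rfl⟩))

/-- The class in `FreePhi4 lam I` of a bracketed word. -/
def FreePhi4.ofWord {k : Type u} {Z : Type v} [Field k] (lam : k)
    (I : AlgIdeal k (MonoidAlgebra k (FreeSemigroup Z))) (w : OpWord Z) : FreePhi4 lam I :=
  (freeIdeal lam I).toAlgIdeal.mkL (MonoidAlgebra.single w 1)

/-- The union of `Irr(G)` with the set of all words
`u₀ ⌊v₁⌋^(k₁) u₁ ⋯ ⌊v_r⌋^(k_r) u_r`, where `r ≥ 1`, `u_i ∈ Irr(G) ∪ {1}`, each `v_j ∈ Z` is not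
the leading basis element of an element of `G₁`, and `k_j ≥ 1`. -/
def basisWords {k : Type u} {Z : Type v} [Field k] [LinearOrder Z]
    (G : Set (MonoidAlgebra k (FreeSemigroup Z))) (G₁ : Set (Z →₀ k)) : Set (OpWord Z) :=
  FreeSemigroup.map OpLetter.var '' Irr G ∪
  {x | ∃ r : ℕ, 1 ≤ r ∧ ∃ (a : Fin (r + 1) → FreeMonoid Z) (b : Fin r → Z) (e : Fin r → ℕ),
    (∀ i, a i ∈ IrrOne G) ∧
    (∀ j, ∀ g ∈ G₁, ¬ IsLeading (· < ·) g (b j)) ∧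
    (∀ j, 1 ≤ e j) ∧
    toMonoid x = FreeMonoid.map OpLetter.var (a 0) *
      (List.ofFn fun j : Fin r =>
        toMonoid (OpWord.bracket^[e j] (OpWord.ofVar (b j))) *
          FreeMonoid.map OpLetter.var (a j.succ)).prod}

end

end PhiFour

open PhiFour

namespace PhiFour

noncomputable section

/-! ## Leading elements and self-reduced bases of subspaces -/

section Linear

variable {ι : Type u} {k : Type v} [Field k] {lt : ι → ι → Prop}

-- The idea is to turn iterated brackets into letters. Let `Y` be `Z` together with one new letter
-- for each `⌊z⌋^(k)`, with `k ≥ 1` and `z` not leading in `G₁`. The map `extHom`, which reads a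
-- letter of `Y` as the bracketed word it denotes, induces an isomorphism from `k S(Y) / (G)` onto
-- the free `φ₄`-algebra. Moreover `G` is still a Gröbner–Shirshov basis over `Y` (`IsGSBasis.map`),
-- so the composition-diamond lemma (`span_irr_sup_ideal`, `IsGSBasis.linearIndependent_irr`) makes
-- the `G`-irreducible words over `Y` a basis. The leading monomials of `G` contain letters of `Z`
-- only, so these words are exactly the `basisWords` (`basisWords_eq_image`).
--
-- Surjectivity (`extHom_surjective`): since `⌊ab⌋ = λ ab`, only brackets of letters need attention.
-- A relation `g = 0` gives `⌊π(g)⌋ = -λ (g - π(g))`, a combination of products; this expresses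
-- `⌊z⌋`, for `z` leading in `G₁`, through brackets of non-leading letters and bracket-free
-- products.
--
-- Injectivity (`exists_retraction`): on `k S(Y) / (G)` consider `x ↦ λ x + T(π(x))` with `T`
-- linear. The linear part `π` kills products, so `φ₄` holds for every `T`, and the operator is well
-- defined as soon as `T` kills `π(G)` (`exists_phi4_operator`). This leaves `T` free on the
-- non-leading and the new letters, where it is chosen so that the operator sends `⌊z⌋^(k)` to
-- `⌊z⌋^(k+1)`. The universal property (`FreePhi4.isFreePhi4Over`) then yields a left inverse.
--
-- The composition-diamond lemma rests on a linear normal form map defined by well-founded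
-- recursion; triviality of compositions shows that it kills the ideal
-- (`IsGSBasis.exists_normalForm`). Existence and uniqueness of `G₁` is reduced row echelon form for
-- a subspace of a space with well-ordered basis.

theorem exists_isLeading (lt : ι → ι → Prop) [IsWellOrder ι lt] {f : ι →₀ k} (hf : f ≠ 0) :
    ∃ b, IsLeading lt f b := by
  classical
  let := linearOrderOfSTO lt
  obtain ⟨b, hb, hmax⟩ := f.support.exists_max_image id (Finsupp.support_nonempty_iff.2 hf)
  exact ⟨b, Finsupp.mem_support_iff.1 hb, fun c hc hcb =>
    lt_of_le_of_ne (hmax c (Finsupp.mem_support_iff.2 hc)) hcb⟩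

theorem IsLeading.ne_zero {f : ι →₀ k} {b : ι} (h : IsLeading lt f b) : f ≠ 0 := by
  rintro rfl
  exact h.1 rfl

theorem IsLeading.smul {f : ι →₀ k} {b : ι} (h : IsLeading lt f b) {c : k} (hc : c ≠ 0) :
    IsLeading lt (c • f) b := by
  refine ⟨by simpa [hc] using h.1, fun d hd hdb => h.2 d ?_ hdb⟩
  intro h0
  simp [h0] at hd

theorem IsLeading.unique [IsWellOrder ι lt] {f : ι →₀ k} {b c : ι} (hb : IsLeading lt f b)
    (hc : IsLeading lt f c) : b = c := by
  by_contra hne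
  exact asymm_of lt (hb.2 c hc.1 (Ne.symm hne)) (hc.2 b hb.1 hne)

/-- The leading basis elements of the vectors of `W`. -/
def leadSet (lt : ι → ι → Prop) (W : Submodule k (ι →₀ k)) : Set ι :=
  {b | ∃ w ∈ W, IsLeading lt w b}

/-- The monic vectors of `W` in which no element of `leadSet lt W` occurs but the leading one. -/
def reducedBasis (lt : ι → ι → Prop) (W : Submodule k (ι →₀ k)) : Set (ι →₀ k) :=
  {t | t ∈ W ∧ ∃ b, IsLeading lt t b ∧ t b = 1 ∧ ∀ c ∈ leadSet lt W, t c ≠ 0 → c = b}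

/-- Well-founded induction on `z`: if `z` leads some `w ∈ W`, then `w z • z - w` involves only
smaller basis elements. -/
theorem single_mem_sup [IsWellOrder ι lt] (W : Submodule k (ι →₀ k)) (z : ι) :
    Finsupp.single z (1 : k) ∈ W ⊔ Finsupp.supported k k (leadSet lt W)ᶜ := by
  induction z using (IsWellFounded.wf (r := lt)).induction with
  | _ z ih =>
    by_cases hz : z ∈ leadSet lt W
    · obtain ⟨w, hw, hl⟩ := hz
      have hlow : Finsupp.single z (w z) - w ∈ W ⊔ Finsupp.supported k k (leadSet lt W)ᶜ := by
        rw [← Finsupp.sum_single (Finsupp.single z (w z) - w)]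
        refine Submodule.sum_mem _ fun c hc => ?_
        have hc' : (Finsupp.single z (w z) - w) c ≠ 0 := Finsupp.mem_support_iff.1 hc
        have hcz : c ≠ z := by
          rintro rfl
          simp at hc'
        have := ih c (hl.2 c (fun h => hc' (by simp [h, hcz.symm])) hcz)
        rw [← mul_one ((Finsupp.single z (w z) - w) c), ← smul_eq_mul, ← Finsupp.smul_single]
        exact Submodule.smul_mem _ _ this
      have h := Submodule.add_mem _ hlow (Submodule.mem_sup_left hw)
      rw [sub_add_cancel] at h
      have h2 := Submodule.smul_mem _ (w z)⁻¹ h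
      rwa [Finsupp.smul_single, smul_eq_mul, inv_mul_cancel₀ hl.1] at h2
    · exact Submodule.mem_sup_right (Finsupp.single_mem_supported k 1 hz)

/-- Split the basis vector at `b` as `w + r` with `w ∈ W` and `r` free of leading elements. Then `b`
is the only element of `leadSet lt W` occurring in `w`, so it must be the leading one. -/
theorem exists_mem_reducedBasis [IsWellOrder ι lt] (W : Submodule k (ι →₀ k)) {b : ι}
    (hb : b ∈ leadSet lt W) : ∃ t ∈ reducedBasis lt W, IsLeading lt t b ∧ t b = 1 := by
  obtain ⟨w, hw, r, hr, hwr⟩ := Submodule.mem_sup.1 (single_mem_sup (lt := lt) W b)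
  have hr0 : ∀ c ∈ leadSet lt W, r c = 0 := fun c hc => by
    by_contra h
    exact (Finsupp.mem_supported k r).1 hr (Finsupp.mem_support_iff.2 h) hc
  have hw1 : w b = 1 := by
    have := DFunLike.congr_fun hwr b
    simpa [hr0 b hb] using this
  have hwc : ∀ c ∈ leadSet lt W, w c ≠ 0 → c = b := fun c hc hwc => by
    by_contra hne
    have := DFunLike.congr_fun hwr c
    simp [hr0 c hc, Ne.symm hne] at this
    exact hwc this
  have hw0 : w ≠ 0 := by
    rintro rfl
    simp at hw1
  obtain ⟨c, hc⟩ := exists_isLeading lt hw0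
  obtain rfl := hwc c ⟨w, hw, hc⟩ hc.1
  exact ⟨w, ⟨hw, c, hc, hw1, hwc⟩, hc, hw1⟩

/-- Subtracting `w b • t b` for every `b ∈ leadSet lt W` occurring in `w` leaves a vector of `W` in
which no element of `leadSet lt W` occurs. Such a vector has no leading element, hence is zero. -/
theorem mem_span_reducedBasis [IsWellOrder ι lt] {W : Submodule k (ι →₀ k)} {w : ι →₀ k}
    (hw : w ∈ W) : w ∈ Submodule.span k (reducedBasis lt W) := by
  classical
  choose! t ht htl ht1 using fun b (hb : b ∈ leadSet lt W) => exists_mem_reducedBasis W hb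
  let S := w.support.filter (· ∈ leadSet lt W)
  have hS : ∀ b ∈ S, b ∈ leadSet lt W := fun b hb => (Finset.mem_filter.1 hb).2
  have hsum : ∑ b ∈ S, w b • t b ∈ Submodule.span k (reducedBasis lt W) :=
    Submodule.sum_mem _ fun b hb => Submodule.smul_mem _ _ (Submodule.subset_span (ht b (hS b hb)))
  have hsumW : ∑ b ∈ S, w b • t b ∈ W :=
    Submodule.sum_mem _ fun b hb => Submodule.smul_mem _ _ (ht b (hS b hb)).1
  have hzero : w - ∑ b ∈ S, w b • t b = 0 := by
    by_contra h0
    obtain ⟨c, hc⟩ := exists_isLeading lt h0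
    have hcL : c ∈ leadSet lt W := ⟨_, W.sub_mem hw hsumW, hc⟩
    apply hc.1
    have hoff : ∀ b ∈ S, b ≠ c → (w b • t b) c = 0 := fun b hb hbc => by
      obtain ⟨-, d, hd, -, hd'⟩ := ht b (hS b hb)
      have hdb : d = b := hd.unique (htl b (hS b hb))
      by_contra h
      exact hbc (((hd' c hcL (fun h' => h (by simp [h']))).trans hdb).symm)
    rw [Finsupp.sub_apply, Finsupp.finsetSum_apply, Finset.sum_eq_single c hoff]
    · simp [ht1 c hcL]
    · intro hcS
      have : w c = 0 := by
        by_contra h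
        exact hcS (Finset.mem_filter.2 ⟨Finsupp.mem_support_iff.2 h, hcL⟩)
      simp [this]
  rw [sub_eq_zero.1 hzero]
  exact hsum

/-- The leading element of a member occurs in no other member, so evaluating a relation there
isolates one coefficient. -/
theorem LinearlySelfReduced.linearIndepOn [IsWellOrder ι lt] {S : Set (ι →₀ k)}
    (hS : LinearlySelfReduced lt S) : LinearIndepOn k id S := by
  classical
  rw [LinearIndepOn, linearIndependent_iff']
  intro s g hg i hi
  obtain ⟨b, hb, hb1⟩ := (hS i i.2).1
  have h := DFunLike.congr_fun hg b
  rw [Finsupp.finsetSum_apply, Finset.sum_eq_single i] at h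
  · simpa [hb1] using h
  · intro j _ hji
    have : (j : ι →₀ k) b = 0 := by
      by_contra hne
      exact (hS j j.2).2 b hne i ⟨i.2, fun h => hji (Subtype.ext h.symm)⟩ hb
    simp [this]
  · exact fun h => (h hi).elim

/-- Two members with the same leading element are equal: their difference lies in `W`, and no
element of `leadSet lt W` survives in it. -/
theorem isSelfReducedBasis_reducedBasis [IsWellOrder ι lt] (W : Submodule k (ι →₀ k)) :
    IsSelfReducedBasis lt (reducedBasis lt W) W := by
  have hS : LinearlySelfReduced lt (reducedBasis lt W) := by
    rintro s ⟨hsW, b, hb, hb1, hbc⟩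
    refine ⟨⟨b, hb, hb1⟩, ?_⟩
    rintro c hc t ⟨⟨htW, d, hd, hd1, hdc⟩, hts⟩ htc
    obtain rfl := hbc c ⟨t, htW, htc⟩ hc
    obtain rfl := hd.unique htc
    apply hts
    by_contra hne
    have h0 : t - s ≠ 0 := sub_ne_zero.2 hne
    obtain ⟨e, he⟩ := exists_isLeading lt h0
    have heL : e ∈ leadSet lt W := ⟨_, W.sub_mem htW hsW, he⟩
    by_cases hed : e = d
    · subst hed
      apply he.1
      simp [hb1, hd1]
    · apply he.1
      have h1 : t e = 0 := by
        by_contra h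
        exact hed (hdc e heL h)
      have h2 : s e = 0 := by
        by_contra h
        exact hed (hbc e heL h)
      simp [h1, h2]
  exact ⟨hS, hS.linearIndepOn, le_antisymm (Submodule.span_le.2 fun t ht => ht.1)
    fun w hw => mem_span_reducedBasis hw⟩

/-- There is no cancellation of leading terms in a combination of `S`: the leading element of each
member used survives. So an `s` in which `c` occurs must be led by `c`, otherwise something larger
than `c` would occur in the combination. -/
theorem IsSelfReducedBasis.exists_isLeading_mem [IsWellOrder ι lt] {S : Set (ι →₀ k)}
    {W : Submodule k (ι →₀ k)} (hS : IsSelfReducedBasis lt S W) {c : ι}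
    (hc : c ∈ leadSet lt W) : ∃ s ∈ S, IsLeading lt s c := by
  classical
  obtain ⟨w, hw, hc⟩ := hc
  rw [← hS.2.2] at hw
  obtain ⟨a, haS, rfl⟩ := Submodule.mem_span_set.1 hw
  obtain ⟨s, hs, hsc⟩ : ∃ s ∈ a.support, (a s • s) c ≠ 0 := by
    by_contra! h
    apply hc.1
    rw [Finsupp.sum, Finsupp.finsetSum_apply]
    exact Finset.sum_eq_zero h
  have hsS : s ∈ S := haS hs
  obtain ⟨⟨b, hb, hb1⟩, -⟩ := hS.1 s hsS
  refine ⟨s, hsS, ?_⟩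
  have hwb : (a.sum fun mi r => r • mi) b ≠ 0 := by
    rw [Finsupp.sum, Finsupp.finsetSum_apply, Finset.sum_eq_single s]
    · simpa [hb1] using hs
    · intro t ht hts
      have : t b = 0 := by
        by_contra h
        exact (hS.1 t (haS ht)).2 b h s ⟨hsS, Ne.symm hts⟩ hb
      simp [this]
    · exact fun h => (h hs).elim
  have hsc' : s c ≠ 0 := fun h => hsc (by simp [h])
  by_contra hne
  have hbc : b ≠ c := by
    rintro rfl
    exact hne hb
  exact asymm_of lt (hb.2 c hsc' hbc.symm) (hc.2 b hwb hbc)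

theorem IsSelfReducedBasis.eq_reducedBasis [IsWellOrder ι lt] {S : Set (ι →₀ k)}
    {W : Submodule k (ι →₀ k)} (hS : IsSelfReducedBasis lt S W) : S = reducedBasis lt W := by
  have hSW : ∀ s ∈ S, s ∈ W := fun s hs => hS.2.2 ▸ Submodule.subset_span hs
  have hsub : S ⊆ reducedBasis lt W := by
    intro s hs
    obtain ⟨⟨b, hb, hb1⟩, hred⟩ := hS.1 s hs
    refine ⟨hSW s hs, b, hb, hb1, fun c hc hsc => ?_⟩
    obtain ⟨t, ht, htc⟩ := hS.exists_isLeading_mem hc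
    by_cases hts : t = s
    · subst hts
      exact htc.unique hb
    · exact (hred c hsc t ⟨ht, hts⟩ htc).elim
  refine hsub.antisymm fun t ht => ?_
  obtain ⟨htW, b, hb, hb1, hbc⟩ := id ht
  obtain ⟨s, hs, hsb⟩ := hS.exists_isLeading_mem ⟨t, htW, hb⟩
  by_contra hne
  have hts : s ≠ t := by
    rintro rfl
    exact hne hs
  exact ((isSelfReducedBasis_reducedBasis W).1 t ht).2 b hb.1 s ⟨hsub hs, hts⟩ hsb

theorem existsUnique_isSelfReducedBasis [IsWellOrder ι lt] (W : Submodule k (ι →₀ k)) :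
    ∃! S : Set (ι →₀ k), IsSelfReducedBasis lt S W :=
  ⟨_, isSelfReducedBasis_reducedBasis W, fun _ h => h.eq_reducedBasis⟩

/-- For a linearly self-reduced set `S`, the leading elements of `S` can be eliminated modulo
`S`: there is a linear map that kills `S`, fixes the basis elements not leading in `S`, and sends
every basis element to a combination of those, congruent to it modulo the span of `S`. -/
theorem LinearlySelfReduced.exists_projection [IsWellOrder ι lt] {S : Set (ι →₀ k)}
    (hS : LinearlySelfReduced lt S) :
    ∃ ρ : (ι →₀ k) →ₗ[k] (ι →₀ k),
      (∀ s ∈ S, ρ s = 0) ∧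
      (∀ z, (∀ s ∈ S, ¬ IsLeading lt s z) → ρ (Finsupp.single z 1) = Finsupp.single z 1) ∧
      (∀ f b, ρ f b ≠ 0 → ∀ s ∈ S, ¬ IsLeading lt s b) ∧
      (∀ f, f - ρ f ∈ Submodule.span k S) := by
  classical
  -- The vector `f` is the image of `z`: it is `z - s` if `z` leads `s ∈ S`, and `z` itself
  -- otherwise. Self-reducedness makes `s` unique and keeps leading elements out of `z - s`.
  have hex : ∀ z, ∃ f : ι →₀ k, (∀ s ∈ S, IsLeading lt s z → f = Finsupp.single z 1 - s) ∧
      ((∀ s ∈ S, ¬ IsLeading lt s z) → f = Finsupp.single z 1) ∧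
      (∀ b, f b ≠ 0 → ∀ s ∈ S, ¬ IsLeading lt s b) ∧
      Finsupp.single z 1 - f ∈ Submodule.span k S := by
    intro z
    by_cases hz : ∃ s ∈ S, IsLeading lt s z
    · obtain ⟨s, hs, hsz⟩ := hz
      obtain ⟨⟨b, hb, hb1⟩, hred⟩ := hS s hs
      obtain rfl := hb.unique hsz
      refine ⟨Finsupp.single b 1 - s, fun t ht htz => ?_, fun h => (h s hs hsz).elim, ?_, ?_⟩
      · by_cases hts : t = s
        · rw [hts]
        · exact (hred b hb.1 t ⟨ht, hts⟩ htz).elim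
      · intro c hc t ht htc
        have hcb : c ≠ b := by
          rintro rfl
          simp [hb1] at hc
        have hsc : s c ≠ 0 := fun h => hc (by simp [h, hcb.symm])
        by_cases hts : t = s
        · subst hts
          exact hcb (htc.unique hb)
        · exact hred c hsc t ⟨ht, hts⟩ htc
      · rw [sub_sub_cancel]
        exact Submodule.subset_span hs
    · push Not at hz
      refine ⟨Finsupp.single z 1, fun s hs h => (hz s hs h).elim, fun _ => rfl, ?_, by simp⟩
      intro b hb
      obtain rfl : z = b := by
        by_contra h
        exact hb (by simp [h])
      exact hz
  choose r hr1 hr2 hr3 hr4 using hex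
  let ρ : (ι →₀ k) →ₗ[k] (ι →₀ k) := Finsupp.linearCombination k r
  have hρ1 : ∀ z, ρ (Finsupp.single z 1) = r z := fun z => by simp [ρ]
  have hρ3 : ∀ f b, ρ f b ≠ 0 → ∀ s ∈ S, ¬ IsLeading lt s b := by
    intro f b hfb
    rw [Finsupp.linearCombination_apply, Finsupp.sum, Finsupp.finsetSum_apply] at hfb
    obtain ⟨z, -, hz⟩ := Finset.exists_ne_zero_of_sum_ne_zero hfb
    exact hr3 z b fun h => hz (by simp [h])
  have hfix : ∀ z, (∀ s ∈ S, ¬ IsLeading lt s z) → ρ (Finsupp.single z 1) = Finsupp.single z 1 :=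
    fun z hz => (hρ1 z).trans (hr2 z hz)
  refine ⟨ρ, fun s hs => ?_, hfix, hρ3, fun f => ?_⟩
  -- Here `s = b - r b`, and `ρ` fixes `r b` since no leading element occurs in it; both terms are
  -- sent to `r b`.
  · obtain ⟨⟨b, hb, hb1⟩, hred⟩ := hS s hs
    have hfix' : ∀ f : ι →₀ k, (∀ c, f c ≠ 0 → ∀ t ∈ S, ¬ IsLeading lt t c) → ρ f = f := by
      intro f hf
      rw [Finsupp.linearCombination_apply]
      conv_rhs => rw [← Finsupp.sum_single f]
      refine Finset.sum_congr rfl fun c hc => ?_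
      change f c • r c = _
      rw [hr2 c (hf c (Finsupp.mem_support_iff.1 hc))]
      simp
    have h1 : ρ (r b) = r b := hfix' _ (hr3 b)
    have h2 : s = Finsupp.single b 1 - r b := by rw [hr1 b s hs hb, sub_sub_cancel]
    rw [h2, map_sub, hρ1, h1, sub_self]
  · induction f using Finsupp.induction_linear with
    | zero => simp
    | add f g hf hg =>
      rw [map_add, add_sub_add_comm]
      exact Submodule.add_mem _ hf hg
    | single z c =>
      have : Finsupp.single z c = c • Finsupp.single z (1 : k) := by simp
      rw [this, map_smul, ← smul_sub, hρ1]
      exact Submodule.smul_mem _ _ (hr4 z)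

end Linear

/-! ## Words -/

section Words

variable {X : Type u}

/-- The list of letters of a nonempty word. -/
def letters (w : FreeSemigroup X) : List X := w.head :: w.tail

theorem letters_injective : Function.Injective (letters (X := X)) := by
  intro a b h
  simp only [letters, List.cons.injEq] at h
  exact FreeSemigroup.ext h.1 h.2

theorem letters_ne_nil (w : FreeSemigroup X) : letters w ≠ [] := List.cons_ne_nil _ _

theorem exists_letters_eq {l : List X} (h : l ≠ []) : ∃ w : FreeSemigroup X, letters w = l := by
  obtain ⟨a, t, rfl⟩ := List.exists_cons_of_ne_nil h
  exact ⟨⟨a, t⟩, rfl⟩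

theorem toList_toMonoid (w : FreeSemigroup X) : FreeMonoid.toList (toMonoid w) = letters w := rfl

theorem letters_mul (a b : FreeSemigroup X) : letters (a * b) = letters a ++ letters b := rfl

theorem letters_of (x : X) : letters (FreeSemigroup.of x) = [x] := rfl

theorem length_letters (w : FreeSemigroup X) : (letters w).length = w.length := rfl

theorem letters_sandwich (p : FreeMonoid X) (w : FreeSemigroup X) (q : FreeMonoid X) :
    letters (sandwich p w q) = FreeMonoid.toList p ++ letters w ++ FreeMonoid.toList q := by
  rw [← toList_toMonoid, toMonoid_sandwich, FreeMonoid.toList_mul, FreeMonoid.toList_mul,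
    toList_toMonoid]

theorem letters_map {Y : Type v} (f : X → Y) (w : FreeSemigroup X) :
    letters (FreeSemigroup.map f w) = (letters w).map f := by
  induction w with
  | ih1 x => rfl
  | ih2 x y _ ih => rw [map_mul, letters_mul, letters_mul, List.map_append, ih]; rfl

theorem sandwich_sandwich (p p' : FreeMonoid X) (w : FreeSemigroup X) (q q' : FreeMonoid X) :
    sandwich p (sandwich p' w q') q = sandwich (p * p') w (q' * q) := by
  apply letters_injective
  simp [letters_sandwich, FreeMonoid.toList_mul]

theorem sandwich_one_one (w : FreeSemigroup X) : sandwich 1 w 1 = w := by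
  apply letters_injective
  simp [letters_sandwich]

theorem mul_sandwich (a : FreeSemigroup X) (p : FreeMonoid X) (w : FreeSemigroup X)
    (q : FreeMonoid X) : a * sandwich p w q = sandwich (toMonoid a * p) w q := by
  apply letters_injective
  simp [letters_sandwich, letters_mul, FreeMonoid.toList_mul, toList_toMonoid]

theorem sandwich_mul (a : FreeSemigroup X) (p : FreeMonoid X) (w : FreeSemigroup X)
    (q : FreeMonoid X) : sandwich p w q * a = sandwich p w (q * toMonoid a) := by
  apply letters_injective
  simp [letters_sandwich, letters_mul, FreeMonoid.toList_mul, toList_toMonoid]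

theorem map_sandwich {Y : Type v} (f : X → Y) (p : FreeMonoid X) (w : FreeSemigroup X)
    (q : FreeMonoid X) : FreeSemigroup.map f (sandwich p w q) =
      sandwich (FreeMonoid.map f p) (FreeSemigroup.map f w) (FreeMonoid.map f q) := by
  apply letters_injective
  simp [letters_sandwich, letters_map, FreeMonoid.toList_map]

theorem map_injective {Y : Type v} {f : X → Y} (hf : Function.Injective f) :
    Function.Injective (FreeSemigroup.map f) := by
  intro a b h
  have := congrArg letters h
  rw [letters_map, letters_map] at this
  exact letters_injective (List.map_injective_iff.2 hf this)

end Words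

-- Degree lexicographic order as a monomial well-order

theorem lex_append_of_length_eq {X : Type u} {r : X → X → Prop} {s s' : List X} (t : List X)
    (hl : s.length = s'.length) (h : List.Lex r s s') : List.Lex r (s ++ t) (s' ++ t) := by
  induction h with
  | nil => simp at hl
  | cons _ ih => exact List.Lex.cons (ih (by simpa using hl))
  | rel h => exact List.Lex.rel h

section Order

variable {X : Type u} [LinearOrder X]

theorem dlexLT_iff (a b : FreeSemigroup X) :
    dlexLT a b ↔ List.Shortlex (· < ·) (letters a) (letters b) := Iff.rfl

instance [WellFoundedLT X] : IsWellOrder (FreeSemigroup X) dlexLT where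
  wf := InvImage.wf letters (List.Shortlex.wf wellFounded_lt)
  trichotomous _ _ h1 h2 := letters_injective
    ((List.Shortlex.trichotomous (r := ((· < ·) : X → X → Prop))).trichotomous _ _ h1 h2)

/-- Compatibility with multiplication on both sides, which makes this a monomial order. -/
theorem dlexLT.sandwich {a b : FreeSemigroup X} (h : dlexLT a b) (p q : FreeMonoid X) :
    dlexLT (sandwich p a q) (sandwich p b q) := by
  rw [dlexLT_iff, letters_sandwich, letters_sandwich, List.append_assoc, List.append_assoc]
  refine List.Shortlex.append_left ?_ _
  rcases List.shortlex_def.1 ((dlexLT_iff _ _).1 h) with h | ⟨h1, h2⟩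
  · exact List.Shortlex.of_length_lt (by simpa using h)
  · exact List.Shortlex.of_lex (by simpa using h1) (lex_append_of_length_eq _ h1 h2)

theorem dlexLT_map {Y : Type v} [LinearOrder Y] {f : X → Y} (hf : StrictMono f)
    {a b : FreeSemigroup X} (h : dlexLT a b) :
    dlexLT (FreeSemigroup.map f a) (FreeSemigroup.map f b) := by
  rw [dlexLT_iff, letters_map, letters_map]
  rcases List.shortlex_def.1 ((dlexLT_iff _ _).1 h) with h | ⟨h1, h2⟩
  · exact List.Shortlex.of_length_lt (by simpa using h)
  · refine List.Shortlex.of_lex (by simpa using h1) ?_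
    generalize letters a = l at h2
    generalize letters b = l' at h2
    induction h2 with
    | nil => exact List.Lex.nil
    | cons _ ih => exact List.Lex.cons ih
    | rel h => exact List.Lex.rel (hf h)

end Order

/-! ## Polynomials between words -/

section Sandwich

variable {k : Type u} {X : Type v} [Field k]

/-- `f ↦ p f q` as a linear map. -/
def sandwichL (k : Type u) {X : Type v} [Field k] (p q : FreeMonoid X) :
    MonoidAlgebra k (FreeSemigroup X) →ₗ[k] MonoidAlgebra k (FreeSemigroup X) :=
  MonoidAlgebra.mapDomainLinearMap k k (fun w => sandwich p w q)

theorem sandwichL_apply (p q : FreeMonoid X) (f : MonoidAlgebra k (FreeSemigroup X)) :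
    sandwichL k p q f = sandwichPoly p f q := rfl

theorem linearMap_ext_single {M : Type*} {V : Type*} [AddCommMonoid V] [Module k V]
    {f g : MonoidAlgebra k M →ₗ[k] V}
    (h : ∀ m, f (MonoidAlgebra.single m 1) = g (MonoidAlgebra.single m 1)) : f = g := by
  ext x
  simpa using h x

theorem eq_sum_single {M : Type*} (f : MonoidAlgebra k M) :
    f = f.coeff.sum fun m c => c • MonoidAlgebra.single m (1 : k) := by
  apply MonoidAlgebra.coeff_injective
  simp

@[simp]
theorem sandwichPoly_single (p q : FreeMonoid X) (w : FreeSemigroup X) (c : k) :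
    sandwichPoly p (MonoidAlgebra.single w c) q = MonoidAlgebra.single (sandwich p w q) c :=
  MonoidAlgebra.mapDomain_single

theorem sandwichPoly_smul (p q : FreeMonoid X) (c : k) (f : MonoidAlgebra k (FreeSemigroup X)) :
    sandwichPoly p (c • f) q = c • sandwichPoly p f q := map_smul (sandwichL k p q) c f

theorem sandwichPoly_sub (p q : FreeMonoid X) (f g : MonoidAlgebra k (FreeSemigroup X)) :
    sandwichPoly p (f - g) q = sandwichPoly p f q - sandwichPoly p g q :=
  map_sub (sandwichL k p q) f g

theorem sandwichPoly_zero (p q : FreeMonoid X) :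
    sandwichPoly p (0 : MonoidAlgebra k (FreeSemigroup X)) q = 0 := map_zero (sandwichL k p q)

theorem sandwichPoly_sandwichPoly (p p' q q' : FreeMonoid X)
    (f : MonoidAlgebra k (FreeSemigroup X)) :
    sandwichPoly p (sandwichPoly p' f q') q = sandwichPoly (p * p') f (q' * q) := by
  have : (sandwichL k p q).comp (sandwichL k p' q') = sandwichL k (p * p') (q' * q) :=
    linearMap_ext_single fun m => by
      simp [sandwichL_apply, sandwich_sandwich]
  exact LinearMap.congr_fun this f

theorem sandwichPoly_one_one (f : MonoidAlgebra k (FreeSemigroup X)) :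
    sandwichPoly 1 f 1 = f := by
  have : sandwichL k (1 : FreeMonoid X) 1 = LinearMap.id :=
    linearMap_ext_single fun m => by
      simp [sandwichL_apply, sandwich_one_one]
  exact LinearMap.congr_fun this f

theorem single_mul_sandwichPoly (a : FreeSemigroup X) (p q : FreeMonoid X)
    (f : MonoidAlgebra k (FreeSemigroup X)) :
    MonoidAlgebra.single a 1 * sandwichPoly p f q = sandwichPoly (toMonoid a * p) f q := by
  have : (LinearMap.mulLeft k (MonoidAlgebra.single a (1 : k))).comp (sandwichL k p q) =
      sandwichL k (toMonoid a * p) q :=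
    linearMap_ext_single fun m => by
      simp [sandwichL_apply, mul_sandwich]
  exact LinearMap.congr_fun this f

theorem sandwichPoly_mul_single (a : FreeSemigroup X) (p q : FreeMonoid X)
    (f : MonoidAlgebra k (FreeSemigroup X)) :
    sandwichPoly p f q * MonoidAlgebra.single a 1 = sandwichPoly p f (q * toMonoid a) := by
  have : (LinearMap.mulRight k (MonoidAlgebra.single a (1 : k))).comp (sandwichL k p q) =
      sandwichL k p (q * toMonoid a) :=
    linearMap_ext_single fun m => by
      simp [sandwichL_apply, sandwich_mul]
  exact LinearMap.congr_fun this f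

/-- Associativity of `f d g` when `d` may be empty and so need not be an element of the nonunital
algebra. -/
theorem sandwichPoly_mul_eq (d : FreeMonoid X) (f g : MonoidAlgebra k (FreeSemigroup X)) :
    sandwichPoly 1 f d * g = f * sandwichPoly d g 1 := by
  have h1 : (LinearMap.mul k (MonoidAlgebra k (FreeSemigroup X))).comp (sandwichL k 1 d) =
      (LinearMap.mul k (MonoidAlgebra k (FreeSemigroup X))).compl₂ (sandwichL k d 1) := by
    refine linearMap_ext_single fun a => linearMap_ext_single fun b => ?_
    simp [sandwichL_apply, mul_sandwich, sandwich_mul]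
    congr 1
    apply letters_injective
    simp [letters_sandwich, FreeMonoid.toList_mul, toList_toMonoid]
  exact LinearMap.congr_fun (LinearMap.congr_fun h1 f) g

end Sandwich

/-! ## The composition-diamond lemma -/

section Diamond

variable {k : Type u} {X : Type v} [Field k] [LinearOrder X]
  {G : Set (MonoidAlgebra k (FreeSemigroup X))}

theorem trivialMod_generator {s : MonoidAlgebra k (FreeSemigroup X)} {m w : FreeSemigroup X}
    {p q : FreeMonoid X} (hs : s ∈ G) (hm : IsLM s m) (hw : dlexLT (sandwich p m q) w) :
    TrivialMod G w (sandwichPoly p s q) :=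
  Submodule.subset_span ⟨s, hs, m, hm, p, q, hw, rfl⟩

theorem TrivialMod.sub {w : FreeSemigroup X} {f g : MonoidAlgebra k (FreeSemigroup X)}
    (hf : TrivialMod G w f) (hg : TrivialMod G w g) : TrivialMod G w (f - g) :=
  Submodule.sub_mem _ hf hg

theorem TrivialMod.smul {w : FreeSemigroup X} {f : MonoidAlgebra k (FreeSemigroup X)}
    (hf : TrivialMod G w f) (c : k) : TrivialMod G w (c • f) :=
  Submodule.smul_mem _ c hf

theorem TrivialMod.neg_sub {w : FreeSemigroup X} {f g : MonoidAlgebra k (FreeSemigroup X)}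
    (hf : TrivialMod G w (f - g)) : TrivialMod G w (g - f) := by
  rw [← _root_.neg_sub]
  exact Submodule.neg_mem _ hf

theorem TrivialMod.sandwich {w : FreeSemigroup X} {f : MonoidAlgebra k (FreeSemigroup X)}
    (hf : TrivialMod G w f) (p q : FreeMonoid X) :
    TrivialMod G (sandwich p w q) (sandwichPoly p f q) := by
  refine (Submodule.span_le (p := (Submodule.span k _).comap (sandwichL k p q))).2 ?_ hf
  rintro _ ⟨s, hs, m, hm, p', q', hlt, rfl⟩
  change TrivialMod G _ (sandwichPoly p (sandwichPoly p' s q') q)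
  rw [sandwichPoly_sandwichPoly]
  refine trivialMod_generator hs hm ?_
  rw [← sandwich_sandwich]
  exact hlt.sandwich p q

/-- Expanding `h` into words `u < w` writes `s d h` as a combination of the `s d u`, whose leading
words lie below `m d w`. -/
theorem trivialMod_sandwichPoly_mul {s : MonoidAlgebra k (FreeSemigroup X)}
    {m w : FreeSemigroup X} (hs : s ∈ G) (hm : IsLM s m) (d : FreeMonoid X)
    (h : MonoidAlgebra k (FreeSemigroup X)) (hh : ∀ u, h.coeff u ≠ 0 → dlexLT u w) :
    TrivialMod G (sandwich 1 m d * w) (sandwichPoly 1 s d * h) := by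
  rw [eq_sum_single h, Finsupp.sum, Finset.mul_sum]
  refine Submodule.sum_mem _ fun u hu => ?_
  rw [mul_smul_comm, sandwichPoly_mul_single]
  refine Submodule.smul_mem _ _ (trivialMod_generator hs hm ?_)
  rw [← sandwich_mul]
  have := (hh u (Finsupp.mem_support_iff.1 hu)).sandwich (toMonoid (sandwich 1 m d)) 1
  rwa [← mul_one (toMonoid (sandwich 1 m d)), ← mul_sandwich, ← mul_sandwich, sandwich_one_one,
    sandwich_one_one] at this

theorem trivialMod_mul_sandwichPoly {s : MonoidAlgebra k (FreeSemigroup X)}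
    {m w : FreeSemigroup X} (hs : s ∈ G) (hm : IsLM s m) (d : FreeMonoid X)
    (h : MonoidAlgebra k (FreeSemigroup X)) (hh : ∀ u, h.coeff u ≠ 0 → dlexLT u w) :
    TrivialMod G (w * sandwich d m 1) (h * sandwichPoly d s 1) := by
  rw [eq_sum_single h, Finsupp.sum, Finset.sum_mul]
  refine Submodule.sum_mem _ fun u hu => ?_
  rw [smul_mul_assoc, single_mul_sandwichPoly]
  refine Submodule.smul_mem _ _ (trivialMod_generator hs hm ?_)
  rw [← mul_sandwich]
  have := (hh u (Finsupp.mem_support_iff.1 hu)).sandwich 1 (toMonoid (sandwich d m 1))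
  rwa [← one_mul (toMonoid (sandwich d m 1)), ← sandwich_mul, ← sandwich_mul, sandwich_one_one,
    sandwich_one_one] at this

theorem monicize_sub_lower {s : MonoidAlgebra k (FreeSemigroup X)} {m : FreeSemigroup X}
    (hm : IsLM s m) (u : FreeSemigroup X)
    (hu : (monicize s m - MonoidAlgebra.single m 1).coeff u ≠ 0) : dlexLT u m := by
  have hum : u ≠ m := by
    rintro rfl
    apply hu
    simp [monicize, inv_mul_cancel₀ hm.1]
  refine hm.2 u (fun h => hu ?_) hum
  simp [monicize, h, hum.symm]

/-- Reducing a word at two disjoint subwords. -/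
theorem trivialMod_disjoint {s₁ s₂ : MonoidAlgebra k (FreeSemigroup X)}
    {m₁ m₂ : FreeSemigroup X} (hs₁ : s₁ ∈ G) (hs₂ : s₂ ∈ G) (hm₁ : IsLM s₁ m₁)
    (hm₂ : IsLM s₂ m₂) (d : FreeMonoid X) :
    TrivialMod G (sandwich 1 m₁ (d * toMonoid m₂))
      (sandwichPoly 1 (monicize s₁ m₁) (d * toMonoid m₂) -
        sandwichPoly (toMonoid m₁ * d) (monicize s₂ m₂) 1) := by
  -- For monic `s₁`, `s₂`, both `s₁ d m₂` and `m₁ d s₂` are compared with `s₁ d s₂`: the differences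
  -- `s₁ d (s₂ - m₂)` and `(s₁ - m₁) d s₂` are trivial.
  have h1 := (trivialMod_sandwichPoly_mul hs₁ hm₁ d _ (monicize_sub_lower hm₂)).smul
    (s₁.coeff m₁)⁻¹
  have h2 := (trivialMod_mul_sandwichPoly hs₂ hm₂ d _ (monicize_sub_lower hm₁)).smul
    (s₂.coeff m₂)⁻¹
  rw [← smul_mul_assoc, ← sandwichPoly_smul, mul_sub, sandwichPoly_mul_single, sandwich_mul] at h1
  rw [← mul_smul_comm, ← sandwichPoly_smul, sub_mul, single_mul_sandwichPoly] at h2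
  have hw : m₁ * sandwich d m₂ 1 = sandwich 1 m₁ (d * toMonoid m₂) := by
    apply letters_injective
    simp [letters_sandwich, letters_mul, FreeMonoid.toList_mul, toList_toMonoid]
  rw [hw] at h2
  have h3 := h2.sub h1
  change TrivialMod G _ (monicize s₁ m₁ * sandwichPoly d (monicize s₂ m₂) 1 - _ -
    (sandwichPoly 1 (monicize s₁ m₁) d * monicize s₂ m₂ - _)) at h3
  rw [sandwichPoly_mul_eq, sub_sub_sub_cancel_left] at h3
  exact h3

/-- Case analysis on the relative position of two occurrences, the first of which begins the word.
Disjoint occurrences are trivial without any hypothesis on compositions; nested ones are inclusion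
compositions, and properly overlapping ones intersection compositions, multiplied by words. -/
theorem trivialMod_of_suffix (hG : IsGSBasis G)
    {s₁ s₂ : MonoidAlgebra k (FreeSemigroup X)}
    {m₁ m₂ : FreeSemigroup X} (hs₁ : s₁ ∈ G) (hs₂ : s₂ ∈ G) (hm₁ : IsLM s₁ m₁)
    (hm₂ : IsLM s₂ m₂) {c q₁ q₂ : FreeMonoid X}
    (h : letters m₁ ++ FreeMonoid.toList q₁ =
      FreeMonoid.toList c ++ (letters m₂ ++ FreeMonoid.toList q₂)) :
    TrivialMod G (sandwich 1 m₁ q₁)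
      (sandwichPoly 1 (monicize s₁ m₁) q₁ - sandwichPoly c (monicize s₂ m₂) q₂) := by
  have hdisj : ∀ d : FreeMonoid X, c = toMonoid m₁ * d → q₁ = d * toMonoid m₂ * q₂ →
      TrivialMod G (sandwich 1 m₁ q₁)
        (sandwichPoly 1 (monicize s₁ m₁) q₁ - sandwichPoly c (monicize s₂ m₂) q₂) := by
    rintro d rfl rfl
    have := (trivialMod_disjoint hs₁ hs₂ hm₁ hm₂ d).sandwich 1 q₂
    rwa [sandwichPoly_sub, sandwichPoly_sandwichPoly, sandwichPoly_sandwichPoly,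
      sandwich_sandwich, one_mul, one_mul, one_mul] at this
  have hincl : ∀ e : FreeMonoid X, m₁ = sandwich c m₂ e → q₂ = e * q₁ →
      TrivialMod G (sandwich 1 m₁ q₁)
        (sandwichPoly 1 (monicize s₁ m₁) q₁ - sandwichPoly c (monicize s₂ m₂) q₂) := by
    rintro e hm rfl
    have := ((hG s₁ hs₁ s₂ hs₂ m₁ m₂ hm₁ hm₂).2 c e hm).sandwich 1 q₁
    rwa [sandwichPoly_sub, sandwichPoly_sandwichPoly, one_mul] at this
  -- Either `m₁` ends before `m₂` begins, with gap `d`, or `m₁ = c d'`. In the latter case either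
  -- `m₂` lies inside `m₁`, or `d'` is the overlap and `m₂ = d' e`.
  rcases List.append_eq_append_iff.1 h with ⟨d, hc, hd⟩ | ⟨d', hl, hd'⟩
  · refine hdisj (FreeMonoid.ofList d) ?_ ?_
    · apply FreeMonoid.toList.injective
      simp [FreeMonoid.toList_mul, toList_toMonoid, hc]
    · apply FreeMonoid.toList.injective
      simp [FreeMonoid.toList_mul, toList_toMonoid, hd]
  rcases List.append_eq_append_iff.1 hd' with ⟨e, he, hq⟩ | ⟨e, he, hq⟩
  · refine hincl (FreeMonoid.ofList e) ?_ ?_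
    · apply letters_injective
      simp [letters_sandwich, hl, he]
    · apply FreeMonoid.toList.injective
      simp [FreeMonoid.toList_mul, hq]
  -- An empty overlap means adjacent occurrences: the disjoint case with empty gap.
  by_cases hd0 : d' = []
  · subst hd0
    refine hdisj 1 ?_ ?_
    · apply FreeMonoid.toList.injective
      simpa [toList_toMonoid] using hl.symm
    · apply FreeMonoid.toList.injective
      simp [FreeMonoid.toList_mul, toList_toMonoid, he, hq]
  -- Here `m₂ = d'` is a suffix of `m₁`.
  by_cases he0 : e = []
  · subst he0
    refine hincl 1 ?_ ?_
    · apply letters_injective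
      simp [letters_sandwich, hl, he]
    · simpa using hq.symm
  -- Here `m₁ = d'` is a prefix of `m₂`: an inclusion with the roles exchanged.
  by_cases hc0 : FreeMonoid.toList c = []
  · obtain rfl : c = 1 := FreeMonoid.toList.injective hc0
    have hm : m₂ = sandwich 1 m₁ (FreeMonoid.ofList e) := by
      apply letters_injective
      rw [letters_sandwich, he]
      simp [hl]
    have hq' : q₁ = FreeMonoid.ofList e * q₂ := by
      apply FreeMonoid.toList.injective
      simp [FreeMonoid.toList_mul, hq]
    have := ((hG s₂ hs₂ s₁ hs₁ m₂ m₁ hm₂ hm₁).2 1 _ hm).sandwich 1 q₂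
    rw [sandwichPoly_sub, sandwichPoly_sandwichPoly, one_mul, ← hq'] at this
    have hw : sandwich 1 m₁ q₁ = sandwich 1 m₂ q₂ := by
      rw [hq', hm, sandwich_sandwich, one_mul]
    rw [hw]
    exact this.neg_sub
  -- All three pieces `c`, `d'`, `e` are nonempty, which is what the two length bounds of an
  -- intersection composition express.
  · obtain ⟨a, rfl⟩ := exists_letters_eq he0
    obtain ⟨b, hb⟩ := exists_letters_eq hc0
    have hcb : c = toMonoid b := FreeMonoid.toList.injective hb.symm
    have hw : m₁ * a = b * m₂ := by
      apply letters_injective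
      rw [letters_mul, letters_mul, hl, he, hb, List.append_assoc]
    have hlen : m₁.length = b.length + d'.length := by
      rw [← length_letters, ← length_letters, hl, hb, List.length_append]
    have hlen₂ : m₂.length = d'.length + a.length := by
      rw [← length_letters, ← length_letters, he, List.length_append]
    have ha : 0 < a.length := Nat.succ_pos _
    have hb' : 0 < b.length := Nat.succ_pos _
    have hd'' : 0 < d'.length := List.length_pos_iff.2 hd0
    have hq' : q₁ = toMonoid a * q₂ := by
      apply FreeMonoid.toList.injective
      simp [FreeMonoid.toList_mul, toList_toMonoid, hq]
    have := ((hG s₁ hs₁ s₂ hs₂ m₁ m₂ hm₁ hm₂).1 a b hw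
      (by rw [FreeSemigroup.length_mul]; omega)
      (by rw [FreeSemigroup.length_mul]; omega)).sandwich 1 q₂
    rw [← sandwichPoly_one_one (monicize s₁ m₁), ← sandwichPoly_one_one (monicize s₂ m₂),
      sandwichPoly_mul_single, single_mul_sandwichPoly, sandwichPoly_sub,
      sandwichPoly_sandwichPoly, sandwichPoly_sandwichPoly, ← sandwich_one_one m₁, sandwich_mul,
      sandwich_sandwich] at this
    simpa [hq', hcb, sandwich_one_one] using this

/-- One of `p₁`, `p₂` is a prefix of the other. By symmetry it may be `p₁`, and removing it reduces
to an occurrence that begins the word. -/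
theorem trivialMod_of_sandwich_eq (hG : IsGSBasis G)
    {s₁ s₂ : MonoidAlgebra k (FreeSemigroup X)}
    {m₁ m₂ : FreeSemigroup X} (hs₁ : s₁ ∈ G) (hs₂ : s₂ ∈ G) (hm₁ : IsLM s₁ m₁)
    (hm₂ : IsLM s₂ m₂) {p₁ q₁ p₂ q₂ : FreeMonoid X}
    (h : sandwich p₁ m₁ q₁ = sandwich p₂ m₂ q₂) :
    TrivialMod G (sandwich p₁ m₁ q₁)
      (sandwichPoly p₁ (monicize s₁ m₁) q₁ - sandwichPoly p₂ (monicize s₂ m₂) q₂) := by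
  have key : ∀ {s₁ s₂ : MonoidAlgebra k (FreeSemigroup X)}
    {m₁ m₂ : FreeSemigroup X} (_ : s₁ ∈ G) (_ : s₂ ∈ G) (_ : IsLM s₁ m₁)
    (_ : IsLM s₂ m₂) {p₁ q₁ p₂ q₂ : FreeMonoid X} (c : List X),
    FreeMonoid.toList p₂ = FreeMonoid.toList p₁ ++ c →
    letters m₁ ++ FreeMonoid.toList q₁ = c ++ (letters m₂ ++ FreeMonoid.toList q₂) →
    TrivialMod G (sandwich p₁ m₁ q₁)
      (sandwichPoly p₁ (monicize s₁ m₁) q₁ - sandwichPoly p₂ (monicize s₂ m₂) q₂) := by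
    intro s₁ s₂ m₁ m₂ hs₁ hs₂ hm₁ hm₂ p₁ q₁ p₂ q₂ c hc h
    have hp : p₂ = p₁ * FreeMonoid.ofList c := by
      apply FreeMonoid.toList.injective
      simpa [FreeMonoid.toList_mul] using hc
    have := (trivialMod_of_suffix hG hs₁ hs₂ hm₁ hm₂ (c := FreeMonoid.ofList c) h).sandwich p₁ 1
    rw [sandwichPoly_sub, sandwichPoly_sandwichPoly, sandwichPoly_sandwichPoly, sandwich_sandwich,
      mul_one, mul_one, mul_one, ← hp] at this
    exact this
  have hl := congrArg letters h
  rw [letters_sandwich, letters_sandwich, List.append_assoc, List.append_assoc] at hl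
  rcases List.append_eq_append_iff.1 hl with ⟨c, hc, h'⟩ | ⟨c, hc, h'⟩
  · exact key hs₁ hs₂ hm₁ hm₂ c hc h'
  · rw [h]
    exact (key hs₂ hs₁ hm₂ hm₁ c hc h').neg_sub

/-! ### Rewriting -/

/-- One rewriting rule is fixed for each reducible word, so iterating it by well-founded recursion
defines `N` on words without any confluence; linearity is by extension. -/
theorem exists_rewriting {M : Type*} {lt : M → M → Prop} (wf : WellFounded lt) (irr : Set M)
    (step : M → MonoidAlgebra k M) (h : ∀ w ∉ irr, ∀ u, (step w).coeff u ≠ 0 → lt u w) :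
    ∃ N : MonoidAlgebra k M →ₗ[k] MonoidAlgebra k M,
      (∀ w ∈ irr, N (MonoidAlgebra.single w 1) = MonoidAlgebra.single w 1) ∧
      ∀ w ∉ irr, N (MonoidAlgebra.single w 1) = N (step w) := by
  classical
  let F : M → MonoidAlgebra k M := wf.fix fun w rec =>
    if w ∈ irr then MonoidAlgebra.single w 1 else
      -- The value `0` only serves the recursion: by `h` every word occurring in `step w` is below
      -- `w`.
      ∑ u ∈ (step w).coeff.support, if hu : lt u w then (step w).coeff u • rec u hu else 0
  have hF : ∀ w, F w = if w ∈ irr then MonoidAlgebra.single w 1 else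
      ∑ u ∈ (step w).coeff.support, if lt u w then (step w).coeff u • F u else 0 :=
    fun w => wf.fix_eq _ w
  let N : MonoidAlgebra k M →ₗ[k] MonoidAlgebra k M :=
    (Finsupp.linearCombination k F).comp (MonoidAlgebra.coeffLinearEquiv k).toLinearMap
  have hN : ∀ x, N x = x.coeff.sum fun u c => c • F u := fun x =>
    Finsupp.linearCombination_apply k x.coeff
  have hN1 : ∀ w, N (MonoidAlgebra.single w 1) = F w := fun w => by simp [hN]
  refine ⟨N, fun w hw => by rw [hN1, hF, if_pos hw], fun w hw => ?_⟩
  rw [hN1, hF, if_neg hw, hN]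
  exact Finset.sum_congr rfl fun u hu => if_pos (h w hw u (Finsupp.mem_support_iff.1 hu))

theorem exists_lower_of_notMem_irr {w : FreeSemigroup X} (hw : w ∉ Irr G) :
    ∃ s ∈ G, ∃ m, IsLM s m ∧ ∃ p q, w = sandwich p m q := by
  simpa [Irr] using hw

theorem single_sub_sandwichPoly_lower {s : MonoidAlgebra k (FreeSemigroup X)}
    {m : FreeSemigroup X} (hm : IsLM s m) (p q : FreeMonoid X) (u : FreeSemigroup X)
    (hu : (MonoidAlgebra.single (sandwich p m q) 1 -
      sandwichPoly p (monicize s m) q).coeff u ≠ 0) : dlexLT u (sandwich p m q) := by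
  classical
  have he : MonoidAlgebra.single (sandwich p m q) 1 - sandwichPoly p (monicize s m) q =
      -sandwichPoly p (monicize s m - MonoidAlgebra.single m 1) q := by
    rw [sandwichPoly_sub, sandwichPoly_single, neg_sub]
  rw [he] at hu
  have hu' : u ∈ (Finsupp.mapDomain (fun w => sandwich p w q)
      (monicize s m - MonoidAlgebra.single m 1).coeff).support := by
    rw [Finsupp.mem_support_iff]
    intro h0
    apply hu
    rw [MonoidAlgebra.coeff_neg, Finsupp.neg_apply, neg_eq_zero]
    exact h0
  obtain ⟨v, hv, rfl⟩ := Finset.mem_image.1 (Finsupp.mapDomain_support hu')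
  exact (monicize_sub_lower hm v (Finsupp.mem_support_iff.1 hv)).sandwich p q

/-- For a Gröbner–Shirshov basis, the normal form is well defined. -/
theorem IsGSBasis.exists_normalForm [WellFoundedLT X] (hG : IsGSBasis G) :
    ∃ N : MonoidAlgebra k (FreeSemigroup X) →ₗ[k] MonoidAlgebra k (FreeSemigroup X),
      (∀ w ∈ Irr G, N (MonoidAlgebra.single w 1) = MonoidAlgebra.single w 1) ∧
      ∀ s ∈ G, ∀ p q, N (sandwichPoly p s q) = 0 := by
  choose! S hS m hm p q hw using fun w (hw : w ∉ Irr G) => exists_lower_of_notMem_irr hw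
  obtain ⟨N, hN1, hN2⟩ := exists_rewriting (IsWellFounded.wf (r := dlexLT)) (Irr G)
    (fun w => MonoidAlgebra.single w 1 - sandwichPoly (p w) (monicize (S w) (m w)) (q w))
    (fun w hw' u hu => by
      have h := single_sub_sandwichPoly_lower (hm w hw') (p w) (q w) u
      rw [← hw w hw'] at h
      exact h hu)
  -- Induction on the leading word `w` of `p s q`. By induction `N` kills whatever is trivial modulo
  -- `w`, and by construction it kills the reduction chosen at `w`; any other reduction at `w`
  -- differs from that one, after monicizing, by something trivial.
  have key : ∀ w, ∀ s ∈ G, ∀ m, IsLM s m → ∀ p q, w = sandwich p m q →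
      N (sandwichPoly p s q) = 0 := by
    intro w
    induction w using (IsWellFounded.wf (r := (dlexLT (Z := X)))).induction with
    | _ w ih =>
      intro s hs m' hm' p' q' hw'
      have htriv : ∀ f, TrivialMod G w f → N f = 0 := by
        intro f hf
        refine (Submodule.span_le (p := LinearMap.ker N)).2 ?_ hf
        rintro _ ⟨t, ht, mt, hmt, pt, qt, hlt, rfl⟩
        exact ih _ hlt t ht mt hmt pt qt rfl
      have hwI : w ∉ Irr G := fun h => h s hs m' hm' p' q' hw'
      have h1 : N (sandwichPoly (p w) (monicize (S w) (m w)) (q w)) = 0 := by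
        have := hN2 w hwI
        rw [map_sub] at this
        exact sub_eq_self.1 this.symm
      have h2 := trivialMod_of_sandwich_eq hG hs (hS w hwI) hm' (hm w hwI)
        (hw'.symm.trans (hw w hwI))
      rw [← hw'] at h2
      have h3 := htriv _ h2
      rw [map_sub, h1, sub_zero, monicize, sandwichPoly_smul, map_smul] at h3
      exact (smul_eq_zero.1 h3).resolve_left (inv_ne_zero hm'.1)
  refine ⟨N, hN1, fun s hs p q => ?_⟩
  -- The zero polynomial has no leading monomial and escapes `key`.
  by_cases h0 : s = 0
  · rw [h0, sandwichPoly_zero, map_zero]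
  · obtain ⟨m, hm⟩ := exists_isLeading dlexLT (mt MonoidAlgebra.coeff_eq_zero.1 h0)
    exact key _ s hs m hm p q rfl

theorem mul_mem_of_single_mul_mem {M : Type*} [Mul M] {W : Submodule k (MonoidAlgebra k M)}
    {x : MonoidAlgebra k M} (h : ∀ m, MonoidAlgebra.single m 1 * x ∈ W) (a : MonoidAlgebra k M) :
    a * x ∈ W := by
  rw [eq_sum_single a, Finsupp.sum, Finset.sum_mul]
  refine Submodule.sum_mem _ fun m _ => ?_
  rw [smul_mul_assoc]
  exact W.smul_mem _ (h m)

theorem mul_mem_of_mul_single_mem {M : Type*} [Mul M] {W : Submodule k (MonoidAlgebra k M)}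
    {x : MonoidAlgebra k M} (h : ∀ m, x * MonoidAlgebra.single m 1 ∈ W) (a : MonoidAlgebra k M) :
    x * a ∈ W := by
  rw [eq_sum_single a, Finsupp.sum, Finset.mul_sum]
  refine Submodule.sum_mem _ fun m _ => ?_
  rw [mul_smul_comm]
  exact W.smul_mem _ (h m)

end Diamond

-- Irreducible words as a basis of the quotient algebra

section Ideal

variable {k : Type u} {X : Type v} [Field k] {G : Set (MonoidAlgebra k (FreeSemigroup X))}

theorem AlgIdeal.subset_span {R : Type*} [NonUnitalRing R] [Module k R] {S : Set R} {x : R}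
    (hx : x ∈ S) : x ∈ (AlgIdeal.span k S).toSubmodule := fun _ hJ => hJ hx

/-- The two-sided ideal generated by `G` is spanned by the polynomials `p s q` with `s ∈ G`. -/
theorem algIdeal_span_toSubmodule (G : Set (MonoidAlgebra k (FreeSemigroup X))) :
    (AlgIdeal.span k G).toSubmodule =
      Submodule.span k {h | ∃ s ∈ G, ∃ p q, h = sandwichPoly p s q} := by
  apply le_antisymm
  · let J : AlgIdeal k (MonoidAlgebra k (FreeSemigroup X)) :=
      { Submodule.span k {h | ∃ s ∈ G, ∃ p q, h = sandwichPoly p s q} with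
        mul_mem_left' := by
          intro a x hx
          refine mul_mem_of_single_mul_mem (fun m => ?_) a
          refine (Submodule.span_le (p := (Submodule.span k _).comap
            (LinearMap.mulLeft k (MonoidAlgebra.single m (1 : k))))).2 ?_ hx
          rintro _ ⟨s, hs, p, q, rfl⟩
          refine Submodule.subset_span ⟨s, hs, toMonoid m * p, q, ?_⟩
          exact single_mul_sandwichPoly m p q s
        mul_mem_right' := by
          intro a x hx
          refine mul_mem_of_mul_single_mem (fun m => ?_) a
          refine (Submodule.span_le (p := (Submodule.span k _).comap
            (LinearMap.mulRight k (MonoidAlgebra.single m (1 : k))))).2 ?_ hx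
          rintro _ ⟨s, hs, p, q, rfl⟩
          refine Submodule.subset_span ⟨s, hs, p, q * toMonoid m, ?_⟩
          exact sandwichPoly_mul_single m p q s }
    intro x hx
    exact hx J fun s hs => Submodule.subset_span ⟨s, hs, 1, 1, (sandwichPoly_one_one s).symm⟩
  · refine Submodule.span_le.2 ?_
    rintro _ ⟨s, hs, p, q, rfl⟩ J hJ
    -- An empty factor is not an element of the algebra, so absorption by `J` applies only when the
    -- factor is nonempty.
    have h1 : sandwichPoly p s 1 ∈ J.toSubmodule := by
      by_cases hp : FreeMonoid.toList p = []
      · obtain rfl : p = 1 := FreeMonoid.toList.injective hp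
        rw [sandwichPoly_one_one]
        exact hJ hs
      · obtain ⟨a, ha⟩ := exists_letters_eq hp
        obtain rfl : toMonoid a = p := FreeMonoid.toList.injective ha
        rw [← mul_one (toMonoid a), ← single_mul_sandwichPoly, sandwichPoly_one_one]
        exact J.mul_mem_left' _ _ (hJ hs)
    by_cases hq : FreeMonoid.toList q = []
    · obtain rfl : q = 1 := FreeMonoid.toList.injective hq
      exact h1
    · obtain ⟨a, ha⟩ := exists_letters_eq hq
      obtain rfl : toMonoid a = q := FreeMonoid.toList.injective ha
      rw [← one_mul (toMonoid a), ← sandwichPoly_mul_single]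
      exact J.mul_mem_right' _ _ h1

variable [LinearOrder X] [WellFoundedLT X]

/-- The irreducible words span the quotient by the ideal generated by `G`. -/
theorem span_irr_sup_ideal (G : Set (MonoidAlgebra k (FreeSemigroup X))) :
    Submodule.span k ((fun w => MonoidAlgebra.single w (1 : k)) '' Irr G) ⊔
      (AlgIdeal.span k G).toSubmodule = ⊤ := by
  rw [eq_top_iff]
  have key : ∀ w : FreeSemigroup X, MonoidAlgebra.single w (1 : k) ∈
      Submodule.span k ((fun w => MonoidAlgebra.single w (1 : k)) '' Irr G) ⊔
      (AlgIdeal.span k G).toSubmodule := by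
    intro w
    induction w using (IsWellFounded.wf (r := (dlexLT (Z := X)))).induction with
    | _ w ih =>
      by_cases hw : w ∈ Irr G
      · exact Submodule.mem_sup_left (Submodule.subset_span ⟨w, hw, rfl⟩)
      · obtain ⟨s, hs, m, hm, p, q, rfl⟩ := exists_lower_of_notMem_irr hw
        rw [← sub_add_cancel (MonoidAlgebra.single (sandwich p m q) (1 : k))
          (sandwichPoly p (monicize s m) q)]
        refine Submodule.add_mem _ ?_ (Submodule.mem_sup_right ?_)
        · rw [eq_sum_single (_ - _)]
          exact Submodule.sum_mem _ fun u hu => Submodule.smul_mem _ _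
            (ih u (single_sub_sandwichPoly_lower hm p q u (Finsupp.mem_support_iff.1 hu)))
        · rw [algIdeal_span_toSubmodule, monicize, sandwichPoly_smul]
          exact Submodule.smul_mem _ _ (Submodule.subset_span ⟨s, hs, p, q, rfl⟩)
  intro x _
  rw [eq_sum_single x]
  exact Submodule.sum_mem _ fun u _ => Submodule.smul_mem _ _ (key u)

/-- The irreducible words with respect to a Gröbner–Shirshov basis are linearly independent in
the quotient. -/
theorem IsGSBasis.linearIndependent_irr (hG : IsGSBasis G) :
    LinearIndependent k fun w : Irr G =>
      (AlgIdeal.span k G).mkL (MonoidAlgebra.single w.1 1) := by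
  obtain ⟨N, hN1, hN2⟩ := hG.exists_normalForm
  have hker : (AlgIdeal.span k G).toSubmodule ≤ LinearMap.ker N := by
    rw [algIdeal_span_toSubmodule]
    refine Submodule.span_le.2 ?_
    rintro _ ⟨s, hs, p, q, rfl⟩
    exact hN2 s hs p q
  -- On the quotient the normal form sends the classes of irreducible words to distinct words, which
  -- are independent.
  let N' : (AlgIdeal.span k G).Quot →ₗ[k] MonoidAlgebra k (FreeSemigroup X) :=
    (AlgIdeal.span k G).toSubmodule.liftQ N hker
  refine LinearIndependent.of_comp
    ((MonoidAlgebra.coeffLinearEquiv k).toLinearMap.comp N') ?_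
  have : (⇑((MonoidAlgebra.coeffLinearEquiv k).toLinearMap.comp N') ∘ fun w : Irr G =>
      (AlgIdeal.span k G).mkL (MonoidAlgebra.single w.1 1)) =
      fun w : Irr G => Finsupp.single w.1 (1 : k) := by
    funext w
    exact congrArg MonoidAlgebra.coeff (hN1 w.1 w.2)
  rw [this]
  exact (Finsupp.linearIndependent_single_one k (FreeSemigroup X)).comp _ Subtype.val_injective

end Ideal

/-! ## Extending the alphabet -/

section Extend

variable {k : Type u} {Z : Type v} {Y : Type w} [Field k]

/-- The homomorphism `k S(Z) → k S(Y)` induced by a map of alphabets. -/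
def alphabetHom (k : Type u) [Field k] (f : Z → Y) :
    MonoidAlgebra k (FreeSemigroup Z) →ₙₐ[k] MonoidAlgebra k (FreeSemigroup Y) :=
  MonoidAlgebra.mapDomainNonUnitalAlgHom k k (FreeSemigroup.map f)

theorem alphabetHom_single (f : Z → Y) (m : FreeSemigroup Z) (c : k) :
    alphabetHom k f (MonoidAlgebra.single m c) =
      MonoidAlgebra.single (FreeSemigroup.map f m) c :=
  MonoidAlgebra.mapDomain_single

theorem alphabetHom_sandwichPoly (f : Z → Y) (p q : FreeMonoid Z)
    (x : MonoidAlgebra k (FreeSemigroup Z)) :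
    alphabetHom k f (sandwichPoly p x q) =
      sandwichPoly (FreeMonoid.map f p) (alphabetHom k f x) (FreeMonoid.map f q) := by
  have : (alphabetHom k f : _ →ₗ[k] _).comp (sandwichL k p q) =
      (sandwichL k (FreeMonoid.map f p) (FreeMonoid.map f q)).comp
        (alphabetHom k f : _ →ₗ[k] _) :=
    linearMap_ext_single fun m => by
      simp [sandwichL_apply, alphabetHom_single, map_sandwich]
  exact LinearMap.congr_fun this x

theorem coeff_alphabetHom_map {f : Z → Y} (hf : Function.Injective f)
    (x : MonoidAlgebra k (FreeSemigroup Z)) (m : FreeSemigroup Z) :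
    (alphabetHom k f x).coeff (FreeSemigroup.map f m) = x.coeff m :=
  Finsupp.mapDomain_apply (map_injective hf) x.coeff m

theorem monicize_alphabetHom {f : Z → Y} (hf : Function.Injective f)
    (x : MonoidAlgebra k (FreeSemigroup Z)) (m : FreeSemigroup Z) :
    monicize (alphabetHom k f x) (FreeSemigroup.map f m) = alphabetHom k f (monicize x m) := by
  rw [monicize, monicize, coeff_alphabetHom_map hf, map_smul]

variable [LinearOrder Z] [LinearOrder Y] {f : Z → Y}

theorem IsLM.map (hf : StrictMono f) {x : MonoidAlgebra k (FreeSemigroup Z)}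
    {m : FreeSemigroup Z} (h : IsLM x m) : IsLM (alphabetHom k f x) (FreeSemigroup.map f m) := by
  classical
  refine ⟨by rw [coeff_alphabetHom_map hf.injective]; exact h.1, fun n hn hnm => ?_⟩
  have hn' : n ∈ (Finsupp.mapDomain (FreeSemigroup.map f) x.coeff).support :=
    Finsupp.mem_support_iff.2 hn
  obtain ⟨c, hc, rfl⟩ := Finset.mem_image.1 (Finsupp.mapDomain_support hn')
  refine dlexLT_map hf (h.2 c (Finsupp.mem_support_iff.1 hc) ?_)
  rintro rfl
  exact hnm rfl

theorem exists_of_isLM_alphabetHom [WellFoundedLT Z] [WellFoundedLT Y] (hf : StrictMono f)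
    {x : MonoidAlgebra k (FreeSemigroup Z)} {n : FreeSemigroup Y}
    (h : IsLM (alphabetHom k f x) n) : ∃ m, IsLM x m ∧ n = FreeSemigroup.map f m := by
  have hx : x.coeff ≠ 0 := fun h0 => h.ne_zero (by
    rw [MonoidAlgebra.coeff_eq_zero] at h0
    rw [h0, map_zero, MonoidAlgebra.coeff_zero])
  obtain ⟨m, hm⟩ := exists_isLeading dlexLT hx
  exact ⟨m, hm, h.unique (IsLM.map hf hm)⟩

theorem TrivialMod.map (hf : StrictMono f) {G : Set (MonoidAlgebra k (FreeSemigroup Z))}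
    {w : FreeSemigroup Z} {x : MonoidAlgebra k (FreeSemigroup Z)} (h : TrivialMod G w x) :
    TrivialMod (alphabetHom k f '' G) (FreeSemigroup.map f w) (alphabetHom k f x) := by
  refine (Submodule.span_le (p := (Submodule.span k _).comap
    (alphabetHom k f : _ →ₗ[k] MonoidAlgebra k (FreeSemigroup Y)))).2 ?_ h
  rintro _ ⟨s, hs, m, hm, p, q, hlt, rfl⟩
  change TrivialMod _ _ (alphabetHom k f (sandwichPoly p s q))
  rw [alphabetHom_sandwichPoly]
  refine trivialMod_generator ⟨s, hs, rfl⟩ (hm.map hf) ?_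
  rw [← map_sandwich]
  exact dlexLT_map hf hlt

/-- Enlarging the alphabet creates no new compositions: in an intersection or inclusion every
cofactor is a piece of a leading monomial, hence a word in the old letters. -/
theorem IsGSBasis.map [WellFoundedLT Z] [WellFoundedLT Y] (hf : StrictMono f)
    {G : Set (MonoidAlgebra k (FreeSemigroup Z))} (hG : IsGSBasis G) :
    IsGSBasis (alphabetHom k f '' G) := by
  rintro _ ⟨s, hs, rfl⟩ _ ⟨t, ht, rfl⟩ n n' hn hn'
  obtain ⟨m, hm, rfl⟩ := exists_of_isLM_alphabetHom hf hn
  obtain ⟨m', hm', rfl⟩ := exists_of_isLM_alphabetHom hf hn'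
  rw [monicize_alphabetHom hf.injective, monicize_alphabetHom hf.injective]
  constructor
  · intro a b hab hmax hlt
    rw [FreeSemigroup.length_mul] at hmax
    rw [FreeSemigroup.length_mul] at hlt
    have hl := congrArg letters hab
    rw [letters_mul, letters_mul, letters_map, letters_map] at hl
    -- The strict upper bound on the length of the overlap word excludes disjoint occurrences, so
    -- that `b` is a prefix of the first leading monomial and `a` a suffix of the second.
    have hla : (letters a).length < (letters m').length := by
      rw [length_letters, length_letters]
      rw [FreeSemigroup.length_map, FreeSemigroup.length_map] at hlt
      omega
    rcases List.append_eq_append_iff.1 hl with ⟨d, -, hd⟩ | ⟨d, hd, hd'⟩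
    · have := congrArg List.length hd
      simp only [List.length_append, List.length_map] at this
      omega
    · obtain ⟨b₀, d₁, hb₀, hb, -⟩ := List.map_eq_append_iff.1 hd
      obtain ⟨d₂, a₀, ha₀, -, ha⟩ := List.map_eq_append_iff.1 hd'
      have ha0 : a₀ ≠ [] := by
        rintro rfl
        exact letters_ne_nil a (by simpa using ha.symm)
      have hb0 : b₀ ≠ [] := by
        rintro rfl
        exact letters_ne_nil b (by simpa using hb.symm)
      obtain ⟨a', rfl⟩ := exists_letters_eq ha0
      obtain ⟨b', rfl⟩ := exists_letters_eq hb0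
      rw [← letters_map] at ha hb
      obtain rfl := letters_injective ha
      obtain rfl := letters_injective hb
      rw [← map_mul, ← map_mul] at hab
      have hab' := map_injective hf.injective hab
      simp only [FreeSemigroup.length_map] at hmax hlt
      have := ((hG s hs t ht m m' hm hm').1 a' b' hab'
        (by rwa [FreeSemigroup.length_mul]) (by rwa [FreeSemigroup.length_mul])).map hf
      rwa [map_sub, map_mul, map_mul, map_mul, alphabetHom_single, alphabetHom_single] at this
  · intro p q hpq
    have hl := congrArg letters hpq
    rw [letters_sandwich, letters_map, letters_map] at hl
    obtain ⟨pm, q₀, hm₁, hpm, hq⟩ := List.map_eq_append_iff.1 hl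
    obtain ⟨p₀, m₀, rfl, hp, hm₂⟩ := List.map_eq_append_iff.1 hpm
    have hp' : p = FreeMonoid.map f (FreeMonoid.ofList p₀) := hp.symm
    have hq' : q = FreeMonoid.map f (FreeMonoid.ofList q₀) := hq.symm
    subst hp' hq'
    rw [← map_sandwich] at hpq
    have := ((hG s hs t ht m m' hm hm').2 _ _ (map_injective hf.injective hpq)).map hf
    rwa [map_sub, alphabetHom_sandwichPoly] at this

theorem mem_irr_alphabetHom [WellFoundedLT Z] [WellFoundedLT Y] (hf : StrictMono f)
    {G : Set (MonoidAlgebra k (FreeSemigroup Z))} {w : FreeSemigroup Y} :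
    w ∈ Irr (alphabetHom k f '' G) ↔
      ∀ g ∈ G, ∀ m, IsLM g m → ¬ (letters m).map f <:+: letters w := by
  constructor
  · rintro h g hg m hm ⟨p, q, hpq⟩
    refine h _ ⟨g, hg, rfl⟩ _ (hm.map hf) (FreeMonoid.ofList p) (FreeMonoid.ofList q) ?_
    apply letters_injective
    rw [letters_sandwich, letters_map, ← hpq]
    rfl
  · rintro h _ ⟨g, hg, rfl⟩ n hn p q rfl
    obtain ⟨m, hm, rfl⟩ := exists_of_isLM_alphabetHom hf hn
    refine h g hg m hm ⟨FreeMonoid.toList p, FreeMonoid.toList q, ?_⟩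
    rw [letters_sandwich, letters_map]

theorem mem_irr_iff {G : Set (MonoidAlgebra k (FreeSemigroup Z))} {w : FreeSemigroup Z} :
    w ∈ Irr G ↔ ∀ g ∈ G, ∀ m, IsLM g m → ¬ letters m <:+: letters w := by
  constructor
  · rintro h g hg m hm ⟨p, q, hpq⟩
    refine h g hg _ hm (FreeMonoid.ofList p) (FreeMonoid.ofList q) ?_
    apply letters_injective
    rw [letters_sandwich, ← hpq]
    rfl
  · rintro h g hg n hn p q rfl
    refine h g hg n hn ⟨FreeMonoid.toList p, FreeMonoid.toList q, ?_⟩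
    rw [letters_sandwich]

end Extend

/-! ## The universal property of `FreePhi4` -/

section Hom

variable {k : Type u} {R : Type v} [Field k] [NonUnitalRing R] [Module k R]

/-- The quotient map `R → R / I` as an algebra homomorphism. -/
def AlgIdeal.mkHom (I : AlgIdeal k R) : R →ₙₐ[k] I.Quot where
  toFun := I.mkL
  map_smul' := map_smul I.mkL
  map_zero' := map_zero I.mkL
  map_add' := map_add I.mkL
  map_mul' := I.mkL_mul

theorem AlgIdeal.mkHom_surjective (I : AlgIdeal k R) : Function.Surjective I.mkHom :=
  I.mkL_surjective

theorem AlgIdeal.mkHom_eq_zero (I : AlgIdeal k R) {x : R} :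
    I.mkHom x = 0 ↔ x ∈ I.toSubmodule :=
  Submodule.Quotient.mk_eq_zero I.toSubmodule

/-- A homomorphism vanishing on the ideal `I` factors through `R / I`. -/
def AlgIdeal.liftHom {B : Type w} [NonUnitalRing B] [Module k B] (I : AlgIdeal k R)
    (h : R →ₙₐ[k] B) (hI : ∀ x ∈ I.toSubmodule, h x = 0) : I.Quot →ₙₐ[k] B :=
  let L : I.Quot →ₗ[k] B := I.toSubmodule.liftQ (h : R →ₗ[k] B) hI
  { toFun := L
    map_smul' := map_smul L
    map_zero' := map_zero L
    map_add' := map_add L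
    map_mul' := by
      intro a b
      obtain ⟨a, rfl⟩ := I.mkL_surjective a
      obtain ⟨b, rfl⟩ := I.mkL_surjective b
      exact map_mul h a b }

/-- The kernel of a homomorphism, as an ideal. -/
def AlgIdeal.ker {B : Type w} [NonUnitalRing B] [Module k B] (h : R →ₙₐ[k] B) :
    AlgIdeal k R :=
  { LinearMap.ker (h : R →ₗ[k] B) with
    mul_mem_left' := fun a x hx => by
      have hx' : h x = 0 := hx
      change h (a * x) = 0
      rw [map_mul, hx', mul_zero]
    mul_mem_right' := fun a x hx => by
      have hx' : h x = 0 := hx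
      change h (x * a) = 0
      rw [map_mul, hx', zero_mul] }

/-- The kernel of a homomorphism of operated algebras, as an operated ideal. -/
def OpIdeal.ker {B : Type w} [NonUnitalRing B] [Module k B] {P : R →ₗ[k] R} {Q : B →ₗ[k] B}
    (h : R →ₙₐ[k] B) (hPQ : ∀ x, h (P x) = Q (h x)) : OpIdeal k P :=
  { AlgIdeal.ker h with
    op_mem' := fun x hx => by
      have hx' : h x = 0 := hx
      change h (P x) = 0
      rw [hPQ, hx', map_zero] }

theorem AlgIdeal.eq_zero_of_mem_span {B : Type w} [NonUnitalRing B] [Module k B] {S : Set R}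
    {h : R →ₙₐ[k] B} (hS : ∀ x ∈ S, h x = 0) {x : R} (hx : x ∈ (AlgIdeal.span k S).toSubmodule) :
    h x = 0 := hx (AlgIdeal.ker h) hS

theorem OpIdeal.eq_zero_of_mem_span {B : Type w} [NonUnitalRing B] [Module k B]
    {P : R →ₗ[k] R} {Q : B →ₗ[k] B} {S : Set R}
    {h : R →ₙₐ[k] B} (hPQ : ∀ x, h (P x) = Q (h x)) (hS : ∀ x ∈ S, h x = 0) {x : R}
    (hx : x ∈ (OpIdeal.span P S).toSubmodule) : h x = 0 := hx (OpIdeal.ker h hPQ) hS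

end Hom

-- Evaluation of bracketed words and induction on them

section Eval

variable {Z : Type v} {B : Type w} [Semigroup B]

mutual

/-- The value of a letter under an assignment of the variables. -/
def evalLetter (f : Z → B) (Q : B → B) : OpLetter Z → B
  | .var z => f z
  | .br w => Q (evalWord f Q w)

/-- The value of a bracketed word under an assignment of the variables. -/
def evalWord (f : Z → B) (Q : B → B) : FreeSemigroup (OpLetter Z) → B
  | ⟨x, t⟩ => evalList f Q (evalLetter f Q x) t

/-- The product of `b` with the values of a list of letters. -/
def evalList (f : Z → B) (Q : B → B) (b : B) : List (OpLetter Z) → B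
  | [] => b
  | x :: t => evalList f Q (b * evalLetter f Q x) t

end

theorem evalList_eq_foldl (f : Z → B) (Q : B → B) (t : List (OpLetter Z)) (b : B) :
    evalList f Q b t = t.foldl (fun a x => a * evalLetter f Q x) b := by
  induction t generalizing b with
  | nil => rw [evalList]; rfl
  | cons x t ih => rw [evalList, ih]; rfl

/-- The structural recursion follows the nesting of the type; identifying it with a lift supplies
multiplicativity. -/
theorem evalWord_eq_lift (f : Z → B) (Q : B → B) (w : OpWord Z) :
    evalWord f Q w = FreeSemigroup.lift (evalLetter f Q) w := by
  obtain ⟨x, t⟩ := w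
  rw [evalWord, evalList_eq_foldl]
  rfl

/-- The type is nested through words and lists, so its recursor has three motives; the two auxiliary
ones say that all letters satisfy `p`. -/
theorem OpLetter.induction {p : OpLetter Z → Prop} (var : ∀ z, p (.var z))
    (br : ∀ w : OpWord Z, (∀ x ∈ letters w, p x) → p (.br w)) (x : OpLetter Z) : p x := by
  refine OpLetter.rec (motive_1 := p) (motive_2 := fun w => ∀ x ∈ letters w, p x)
    (motive_3 := fun t => ∀ x ∈ t, p x) var br ?_ ?_ ?_ x
  · intro x t hx ht y hy
    rcases List.mem_cons.1 hy with rfl | hy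
    · exact hx
    · exact ht y hy
  · intro x hx
    simp at hx
  · intro x t hx ht y hy
    rcases List.mem_cons.1 hy with rfl | hy
    · exact hx
    · exact ht y hy

theorem FreeSemigroup.induction_of_letters {X : Type v} {p : FreeSemigroup X → Prop}
    (mul : ∀ a b, p a → p b → p (a * b)) (w : FreeSemigroup X)
    (h : ∀ x ∈ letters w, p (FreeSemigroup.of x)) : p w := by
  induction w with
  | ih1 x => exact h x (List.mem_singleton_self x)
  | ih2 x y _ ih =>
    exact mul _ _ (h x List.mem_cons_self) (ih fun z hz => h z (List.mem_cons_of_mem _ hz))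

theorem OpWord.induction {p : OpWord Z → Prop} (var : ∀ z, p (OpWord.ofVar z))
    (bracket : ∀ w, p w → p (OpWord.bracket w)) (mul : ∀ a b, p a → p b → p (a * b))
    (w : OpWord Z) : p w :=
  FreeSemigroup.induction_of_letters mul w fun x _ =>
    OpLetter.induction (p := fun x => p (FreeSemigroup.of x)) var
      (fun w hw => bracket w (FreeSemigroup.induction_of_letters mul w hw)) x

end Eval

-- Freeness of the quotient

section Universal

variable {k : Type u} {Z : Type v} [Field k]

theorem isPhi4Algebra_of_mul {R : Type w} [NonUnitalRing R] [Module k R] {lam : k}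
    {P : R →ₗ[k] R} (h : ∀ a b, P (a * b) = lam • (a * b)) : IsPhi4Algebra lam P :=
  fun a b => sub_eq_zero.2 (h a b)

theorem IsPhi4Algebra.op_mul {R : Type w} [NonUnitalRing R] [Module k R] {lam : k}
    {P : R →ₗ[k] R} (h : IsPhi4Algebra lam P) (a b : R) : P (a * b) = lam • (a * b) :=
  sub_eq_zero.1 (h a b)

/-- Evaluation of bracketed polynomials in an operated algebra. -/
def evalHom {B : Type w} [NonUnitalRing B] [Module k B] [IsScalarTower k B B]
    [SMulCommClass k B B] (f : Z → B) (Q : B →ₗ[k] B) :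
    MonoidAlgebra k (OpWord Z) →ₙₐ[k] B :=
  MonoidAlgebra.liftMagma k (FreeSemigroup.lift (evalLetter f Q))

section

variable {B : Type w} [NonUnitalRing B] [Module k B] [IsScalarTower k B B]
    [SMulCommClass k B B] (f : Z → B) (Q : B →ₗ[k] B)

theorem evalHom_single (w : OpWord Z) :
    evalHom f Q (MonoidAlgebra.single w (1 : k)) = FreeSemigroup.lift (evalLetter f Q) w := by
  simp [evalHom, MonoidAlgebra.liftMagma_apply_apply]

theorem evalHom_ofVar (z : Z) :
    evalHom f Q (MonoidAlgebra.single (OpWord.ofVar z) (1 : k)) = f z := by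
  rw [evalHom_single, OpWord.ofVar, FreeSemigroup.lift_of, evalLetter]

theorem evalHom_bracket (x : MonoidAlgebra k (OpWord Z)) :
    evalHom f Q (bracketL k Z x) = Q (evalHom f Q x) := by
  have : (evalHom f Q : _ →ₗ[k] B).comp (bracketL k Z) = Q.comp (evalHom f Q : _ →ₗ[k] B) := by
    refine linearMap_ext_single fun w => ?_
    change evalHom f Q (bracketL k Z _) = Q (evalHom f Q _)
    rw [bracketL, MonoidAlgebra.mapDomainLinearMap_single, evalHom_single, evalHom_single,
      OpWord.bracket, FreeSemigroup.lift_of, evalLetter, evalWord_eq_lift]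
  exact LinearMap.congr_fun this x

end

variable (lam : k) (I : AlgIdeal k (MonoidAlgebra k (FreeSemigroup Z)))

/-- The quotient map `k 𝔖(Z) → FreePhi4 lam I`. -/
abbrev FreePhi4.mk : MonoidAlgebra k (OpWord Z) →ₙₐ[k] FreePhi4 lam I :=
  (freeIdeal lam I).toAlgIdeal.mkHom

theorem FreePhi4.op_mk (x : MonoidAlgebra k (OpWord Z)) :
    FreePhi4.op lam I (FreePhi4.mk lam I x) = FreePhi4.mk lam I (bracketL k Z x) := rfl

theorem FreePhi4.incl_mk (x : MonoidAlgebra k (FreeSemigroup Z)) :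
    FreePhi4.incl lam I (I.mkHom x) = FreePhi4.mk lam I (inclHom k Z x) := rfl

theorem inclHom_single (w : FreeSemigroup Z) :
    inclHom k Z (MonoidAlgebra.single w 1) =
      MonoidAlgebra.single (FreeSemigroup.map OpLetter.var w) 1 :=
  MonoidAlgebra.mapDomain_single

theorem bracketL_single (w : OpWord Z) :
    bracketL k Z (MonoidAlgebra.single w 1) = MonoidAlgebra.single (OpWord.bracket w) 1 :=
  MonoidAlgebra.mapDomainLinearMap_single _ _ _

/-- The ideal contains `φ₄(u, v)` for words only; bilinearity of `φ₄` extends this to all elements.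
-/
theorem FreePhi4.isPhi4Algebra : IsPhi4Algebra lam (FreePhi4.op lam I) := by
  refine isPhi4Algebra_of_mul fun a b => ?_
  obtain ⟨a, rfl⟩ := (freeIdeal lam I).toAlgIdeal.mkHom_surjective a
  obtain ⟨b, rfl⟩ := (freeIdeal lam I).toAlgIdeal.mkHom_surjective b
  rw [← map_mul, FreePhi4.op_mk, ← map_smul, ← sub_eq_zero, ← map_sub, AlgIdeal.mkHom_eq_zero]
  have hL : ∀ y : OpWord Z, ∀ x : MonoidAlgebra k (OpWord Z),
      ((bracketL k Z - lam • LinearMap.id).comp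
        (LinearMap.mulRight k (MonoidAlgebra.single y 1))) x ∈
        (freeIdeal lam I).toSubmodule := by
    intro y x
    rw [eq_sum_single x, Finsupp.sum, map_sum]
    refine Submodule.sum_mem _ fun m _ => ?_
    rw [map_smul]
    exact Submodule.smul_mem _ _ (OpIdeal.subset_span _ _ (Or.inl ⟨m, y, rfl⟩))
  change ((bracketL k Z - lam • LinearMap.id).comp (LinearMap.mulLeft k a)) b ∈ _
  rw [eq_sum_single b, Finsupp.sum, map_sum]
  refine Submodule.sum_mem _ fun m _ => ?_
  rw [map_smul]
  exact Submodule.smul_mem _ _ (hL m a)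

/-- Homomorphisms out of `FreePhi4 lam I` respecting the operators are determined by their values
on the variables. -/
theorem FreePhi4.hom_ext {B : Type w} [NonUnitalRing B] [Module k B] {Q : B →ₗ[k] B}
    {g g' : FreePhi4 lam I →ₙₐ[k] B} (hg : ∀ x, g (FreePhi4.op lam I x) = Q (g x))
    (hg' : ∀ x, g' (FreePhi4.op lam I x) = Q (g' x))
    (h : ∀ z, g (FreePhi4.ofWord lam I (OpWord.ofVar z)) =
      g' (FreePhi4.ofWord lam I (OpWord.ofVar z))) : g = g' := by
  have hw : ∀ w : OpWord Z, g (FreePhi4.mk lam I (MonoidAlgebra.single w 1)) =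
      g' (FreePhi4.mk lam I (MonoidAlgebra.single w 1)) := by
    intro w
    induction w using OpWord.induction with
    | var z => exact h z
    | bracket w ih => rw [← bracketL_single, ← FreePhi4.op_mk, hg, hg', ih]
    | mul a b iha ihb =>
      rw [← mul_one (1 : k), ← MonoidAlgebra.single_mul_single, map_mul, map_mul, map_mul, iha,
        ihb]
  have : g.comp (FreePhi4.mk lam I) = g'.comp (FreePhi4.mk lam I) :=
    MonoidAlgebra.nonUnitalAlgHom_ext k hw
  ext x
  obtain ⟨x, rfl⟩ := (freeIdeal lam I).toAlgIdeal.mkHom_surjective x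
  exact DFunLike.congr_fun this x

/-- Evaluating each variable at its image under `f` respects the operators, kills the `φ₄` relations
because `Q` satisfies them, and kills the ideal because it restricts to `f`. Uniqueness holds since
variables generate under product and bracket. -/
theorem FreePhi4.isFreePhi4Over :
    IsFreePhi4Over.{w} lam (FreePhi4.op lam I) (FreePhi4.incl lam I) := by
  refine ⟨FreePhi4.isPhi4Algebra lam I, ?_⟩
  intro B _ _ _ _ Q hQ f
  let e : MonoidAlgebra k (OpWord Z) →ₙₐ[k] B :=
    evalHom (fun z => f (I.mkHom (MonoidAlgebra.single (FreeSemigroup.of z) 1))) Q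
  have he : ∀ x, e (inclHom k Z x) = f (I.mkHom x) := by
    have : e.comp (inclHom k Z) = f.comp I.mkHom := by
      refine MonoidAlgebra.nonUnitalAlgHom_ext k fun w => ?_
      rw [NonUnitalAlgHom.comp_apply, NonUnitalAlgHom.comp_apply]
      induction w with
      | ih1 z => exact (congrArg e (inclHom_single _)).trans (evalHom_ofVar _ Q z)
      | ih2 z w hz hw =>
        rw [← mul_one (1 : k), ← MonoidAlgebra.single_mul_single, map_mul, map_mul, map_mul,
          map_mul, hz, hw]
    exact fun x => DFunLike.congr_fun this x
  have hker : ∀ x ∈ (freeIdeal lam I).toSubmodule, e x = 0 := by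
    intro x hx
    refine OpIdeal.eq_zero_of_mem_span (evalHom_bracket _ Q) ?_ hx
    rintro _ (⟨a, b, rfl⟩ | ⟨y, hy, rfl⟩)
    · change e _ = 0
      rw [phi4, map_sub, map_smul]
      refine sub_eq_zero.2 ((evalHom_bracket _ Q _).trans ?_)
      change Q (e _) = _
      rw [map_mul, hQ.op_mul]
    · change e _ = 0
      rw [he, (AlgIdeal.mkHom_eq_zero I).2 hy, map_zero]
  have hop : ∀ x, (freeIdeal lam I).toAlgIdeal.liftHom e hker (FreePhi4.op lam I x) =
      Q ((freeIdeal lam I).toAlgIdeal.liftHom e hker x) := by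
    intro x
    obtain ⟨x, rfl⟩ := (freeIdeal lam I).toAlgIdeal.mkHom_surjective x
    exact evalHom_bracket _ Q x
  have hincl : ∀ a, (freeIdeal lam I).toAlgIdeal.liftHom e hker (FreePhi4.incl lam I a) = f a := by
    intro a
    obtain ⟨a, rfl⟩ := I.mkHom_surjective a
    exact he a
  refine ⟨_, ⟨hop, hincl⟩, ?_⟩
  rintro g ⟨hg, hgi⟩
  refine FreePhi4.hom_ext lam I hg hop fun z => ?_
  have hz : FreePhi4.ofWord lam I (OpWord.ofVar z) =
      FreePhi4.incl lam I (I.mkHom (MonoidAlgebra.single (FreeSemigroup.of z) 1)) := by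
    rw [FreePhi4.incl_mk, inclHom_single]
    rfl
  rw [hz, hgi, hincl]

end Universal

/-! ## The alphabet of variables and iterated brackets -/

section Alphabet

variable {Z : Type v} {p : Z → Prop}

/-- The alphabet consisting of the letters `z ∈ Z` and of symbols for `⌊z⌋^(n+1)`, for the `z`
satisfying `p`. -/
abbrev ExtLetter (p : Z → Prop) : Type v := Z ⊕ₗ ({z // p z} ×ₗ ℕ)

/-- A letter `z ∈ Z` as a letter of the extended alphabet. -/
def ExtLetter.var (p : Z → Prop) (z : Z) : ExtLetter p := toLex (Sum.inl z)

/-- The symbol for `⌊z⌋^(n+1)`. -/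
def ExtLetter.power (z : {z // p z}) (n : ℕ) : ExtLetter p := toLex (Sum.inr (toLex (z, n)))

theorem ExtLetter.cases {motive : ExtLetter p → Prop} (var : ∀ z, motive (ExtLetter.var p z))
    (power : ∀ z n, motive (ExtLetter.power z n)) (x : ExtLetter p) : motive x := by
  obtain ⟨x, rfl⟩ := toLex.surjective x
  rcases x with z | y
  · exact var z
  · exact power (ofLex y).1 (ofLex y).2

theorem ExtLetter.var_ne_power (z : Z) (y : {z // p z}) (n : ℕ) :
    ExtLetter.var p z ≠ ExtLetter.power y n := by
  intro h
  exact Sum.inl_ne_inr (toLex.injective h)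

instance {α β : Type*} [LinearOrder α] [LinearOrder β] [WellFoundedLT α] [WellFoundedLT β] :
    WellFoundedLT (α ⊕ₗ β) where
  wf := Sum.lex_wf wellFounded_lt wellFounded_lt

/-- Beyond being a linear well-order, this is all that is needed of the order on the extended
alphabet. -/
theorem ExtLetter.var_strictMono [LinearOrder Z] : StrictMono (ExtLetter.var p) :=
  Sum.Lex.inl_strictMono

instance [LinearOrder Z] [WellFoundedLT Z] : WellFoundedLT (ExtLetter p) :=
  haveI : WellFoundedLT ({z // p z} ×ₗ ℕ) := inferInstance
  inferInstance

/-- The letter `⌊z⌋^(n+1)` of bracketed words. -/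
def powerLetter (z : Z) (n : ℕ) : OpLetter Z := .br (OpWord.bracket^[n] (OpWord.ofVar z))

theorem of_powerLetter (z : Z) (n : ℕ) :
    FreeSemigroup.of (powerLetter z n) = OpWord.bracket^[n + 1] (OpWord.ofVar z) := by
  rw [Function.iterate_succ_apply']
  rfl

theorem bracket_of_powerLetter (z : Z) (n : ℕ) :
    OpWord.bracket (FreeSemigroup.of (powerLetter z n)) =
      FreeSemigroup.of (powerLetter z (n + 1)) := by
  rw [of_powerLetter, of_powerLetter, Function.iterate_succ_apply' _ (n + 1)]

/-- The letter of bracketed words denoted by a letter of the extended alphabet. -/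
def ExtLetter.toOp (x : ExtLetter p) : OpLetter Z :=
  match ofLex x with
  | .inl z => .var z
  | .inr y => powerLetter (ofLex y).1 (ofLex y).2

theorem ExtLetter.toOp_power (z : {z // p z}) (n : ℕ) :
    (ExtLetter.power z n).toOp = powerLetter z.1 n := rfl

end Alphabet

/-! ## Block decompositions of words -/

section Blocks

/-- A subword avoiding the letter `x` cannot straddle it. -/
theorem infix_append_cons_iff {α : Type*} {l l₁ l₂ : List α} {x : α} (hx : x ∉ l) :
    l <:+: l₁ ++ x :: l₂ ↔ l <:+: l₁ ∨ l <:+: l₂ := by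
  constructor
  · rw [List.infix_append_iff]
    rintro (h | h | ⟨a, b, rfl, ha, hb⟩)
    · exact Or.inl h
    · rcases List.infix_cons_iff.1 h with h | h
      · cases l with
        | nil => exact Or.inl (List.nil_infix)
        | cons y l =>
          obtain ⟨rfl, -⟩ := List.cons_prefix_cons.1 h
          simp at hx
      · exact Or.inr h
    · cases b with
      | nil =>
        rw [List.append_nil]
        exact Or.inl ha.isInfix
      | cons y b =>
        obtain ⟨rfl, -⟩ := List.cons_prefix_cons.1 hb
        simp at hx
  · rintro (h | h)
    · exact h.trans (List.prefix_append _ _).isInfix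
    · exact h.trans ((List.suffix_cons _ _).trans (List.suffix_append _ _)).isInfix

theorem map_infix_map_iff {α β : Type*} {f : α → β} (hf : Function.Injective f) {l l' : List α} :
    l.map f <:+: l'.map f ↔ l <:+: l' := by
  refine ⟨?_, fun h => h.map f⟩
  rintro ⟨s, t, h⟩
  obtain ⟨a, t', rfl, ha, -⟩ := List.map_eq_append_iff.1 h.symm
  obtain ⟨s', m, rfl, -, hm⟩ := List.map_eq_append_iff.1 ha
  obtain rfl := List.map_injective_iff.2 hf hm
  exact ⟨s', t', rfl⟩

variable {Z : Type v} {p : Z → Prop}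

/-- The word `a₀ ⌊b₁⌋^(e₁+1) a₁ ⋯ ⌊b_r⌋^(e_r+1) a_r` in the extended alphabet. -/
def blockList {r : ℕ} (a : Fin (r + 1) → List Z) (b : Fin r → {z // p z}) (e : Fin r → ℕ) :
    List (ExtLetter p) :=
  (a 0).map (ExtLetter.var p) ++
    (List.ofFn fun j => ExtLetter.power (b j) (e j) :: (a j.succ).map (ExtLetter.var p)).flatten

theorem blockList_succ {r : ℕ} (a : Fin (r + 2) → List Z) (b : Fin (r + 1) → {z // p z})
    (e : Fin (r + 1) → ℕ) :
    blockList a b e = (a 0).map (ExtLetter.var p) ++ ExtLetter.power (b 0) (e 0) ::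
      blockList (fun i => a i.succ) (fun j => b j.succ) (fun j => e j.succ) := by
  rw [blockList, List.ofFn_succ, List.flatten_cons]
  rfl

/-- Reading from the right, a variable is prepended to the first block, while a power letter opens a
new, empty first block. -/
theorem exists_blockList_eq (l : List (ExtLetter p)) :
    ∃ (r : ℕ) (a : Fin (r + 1) → List Z) (b : Fin r → {z // p z}) (e : Fin r → ℕ),
      l = blockList a b e := by
  induction l with
  | nil => exact ⟨0, fun _ => [], Fin.elim0, Fin.elim0, rfl⟩
  | cons x l ih =>
    obtain ⟨r, a, b, e, rfl⟩ := ih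
    induction x using ExtLetter.cases with
    | var z =>
      exact ⟨r, Fin.cons (z :: a 0) fun i => a i.succ, b, e, by simp [blockList]⟩
    | power z n =>
      exact ⟨r + 1, Fin.cons [] a, Fin.cons z b, Fin.cons n e, by
        rw [blockList_succ]
        simp⟩

/-- The power letters act as separators, so irreducibility is tested block by block. -/
theorem infix_blockList_iff {r : ℕ} (a : Fin (r + 1) → List Z) (b : Fin r → {z // p z})
    (e : Fin r → ℕ) (m : List Z) :
    m.map (ExtLetter.var p) <:+: blockList a b e ↔ ∃ i, m <:+: a i := by
  have hinj : Function.Injective (ExtLetter.var p) := fun x y h => Sum.inl_injective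
    (toLex.injective h)
  induction r with
  | zero =>
    simp [blockList, map_infix_map_iff hinj]
  | succ r ih =>
    have hb : ExtLetter.power (b 0) (e 0) ∉ m.map (ExtLetter.var p) := by
      intro h
      obtain ⟨z, -, hz⟩ := List.mem_map.1 h
      exact ExtLetter.var_ne_power _ _ _ hz
    rw [blockList_succ, infix_append_cons_iff hb, map_infix_map_iff hinj, Fin.exists_fin_succ]
    exact or_congr_right (ih _ _ _)

theorem map_toOp_blockList {r : ℕ} (a : Fin (r + 1) → List Z) (b : Fin r → {z // p z})
    (e : Fin r → ℕ) :
    (blockList a b e).map ExtLetter.toOp = FreeMonoid.toList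
      (FreeMonoid.map OpLetter.var (FreeMonoid.ofList (a 0)) *
      (List.ofFn fun j : Fin r =>
        toMonoid (OpWord.bracket^[e j + 1] (OpWord.ofVar (b j).1)) *
          FreeMonoid.map OpLetter.var (FreeMonoid.ofList (a j.succ))).prod) := by
  have hvar : ExtLetter.toOp ∘ ExtLetter.var p = OpLetter.var := rfl
  rw [blockList, List.map_append, List.map_map, hvar, FreeMonoid.toList_mul,
    FreeMonoid.toList_prod, FreeMonoid.toList_map, List.map_flatten, List.map_ofFn,
    List.map_ofFn]
  congr 3
  funext j
  simp only [Function.comp_apply, List.map_cons, List.map_map, hvar, FreeMonoid.toList_mul,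
    FreeMonoid.toList_map, toList_toMonoid, ← of_powerLetter, letters_of, ExtLetter.toOp_power]
  rfl

end Blocks

-- Basis words as irreducible words over the extended alphabet

section BasisWords

variable {k : Type u} {Z : Type v} [Field k] [LinearOrder Z]

theorem ofList_mem_irrOne_iff {G : Set (MonoidAlgebra k (FreeSemigroup Z))} {l : List Z} :
    FreeMonoid.ofList l ∈ IrrOne G ↔ ∀ g ∈ G, ∀ m, IsLM g m → ¬ letters m <:+: l := by
  constructor
  · rintro (⟨w, hw, h⟩ | h)
    · obtain rfl : letters w = l := FreeMonoid.ofList.injective h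
      exact mem_irr_iff.1 hw
    · obtain rfl : l = [] := FreeMonoid.ofList.injective h
      intro g _ m _ hm
      exact letters_ne_nil m (List.eq_nil_of_infix_nil hm)
  · intro h
    by_cases hl : l = []
    · subst hl
      exact Or.inr rfl
    · obtain ⟨w, rfl⟩ := exists_letters_eq hl
      exact Or.inl ⟨w, mem_irr_iff.2 h, rfl⟩

/-- The basis words are the words in the extended alphabet that are irreducible with respect
to `G`. -/
theorem basisWords_eq_image [WellFoundedLT Z] (G : Set (MonoidAlgebra k (FreeSemigroup Z)))
    (G₁ : Set (Z →₀ k)) :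
    basisWords G G₁ =
      FreeSemigroup.map (ExtLetter.toOp (p := fun z => ∀ g ∈ G₁, ¬ IsLeading (· < ·) g z)) ''
        Irr (alphabetHom k (ExtLetter.var fun z => ∀ g ∈ G₁, ¬ IsLeading (· < ·) g z) '' G) := by
  ext x
  constructor
  · rintro (⟨w, hw, rfl⟩ | ⟨r, -, a, b, e, ha, hb, he, hx⟩)
    · refine ⟨FreeSemigroup.map (ExtLetter.var _) w, ?_, ?_⟩
      · rw [mem_irr_alphabetHom ExtLetter.var_strictMono]
        intro g hg m hm h
        rw [letters_map, map_infix_map_iff ExtLetter.var_strictMono.injective] at h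
        exact mem_irr_iff.1 hw g hg m hm h
      · apply letters_injective
        rw [letters_map, letters_map, letters_map, List.map_map]
        rfl
    · have hl := map_toOp_blockList (fun i => FreeMonoid.toList (a i))
        (fun j => (⟨b j, hb j⟩ : {z // ∀ g ∈ G₁, ¬ IsLeading (· < ·) g z})) (fun j => e j - 1)
      -- The letter with index `n` stands for `n + 1` brackets; truncated subtraction is exact since
      -- `1 ≤ e j`.
      have he' : ∀ j, e j - 1 + 1 = e j := fun j => Nat.sub_add_cancel (he j)
      simp only [he', FreeMonoid.ofList_toList] at hl
      rw [← hx, toList_toMonoid] at hl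
      obtain ⟨u, hu⟩ := exists_letters_eq (l := blockList (fun i => FreeMonoid.toList (a i))
        (fun j => (⟨b j, hb j⟩ : {z // ∀ g ∈ G₁, ¬ IsLeading (· < ·) g z})) (fun j => e j - 1))
        (by
          intro h
          rw [h] at hl
          exact letters_ne_nil x hl.symm)
      refine ⟨u, ?_, ?_⟩
      · rw [mem_irr_alphabetHom ExtLetter.var_strictMono, hu]
        intro g hg m hm h
        obtain ⟨i, hi⟩ := (infix_blockList_iff _ _ _ _).1 h
        exact ofList_mem_irrOne_iff.1 (ha i) g hg m hm hi
      · apply letters_injective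
        rw [letters_map, hu, hl]
  · rintro ⟨u, hu, rfl⟩
    obtain ⟨r, a, b, e, hl⟩ := exists_blockList_eq (letters u)
    rw [mem_irr_alphabetHom ExtLetter.var_strictMono, hl] at hu
    have ha : ∀ i, FreeMonoid.ofList (a i) ∈ IrrOne G := fun i =>
      ofList_mem_irrOne_iff.2 fun g hg m hm h =>
        hu g hg m hm ((infix_blockList_iff _ _ _ _).2 ⟨i, h⟩)
    have hx := map_toOp_blockList a b e
    rw [← hl, ← letters_map, ← toList_toMonoid] at hx
    -- Without brackets the word is a single block, nonempty because `u` is, and so belongs to `Irr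
    -- G`.
    by_cases hr : r = 0
    · subst hr
      left
      rcases ha 0 with ⟨w, hw, h⟩ | h
      · refine ⟨w, hw, ?_⟩
        apply letters_injective
        rw [← toList_toMonoid (FreeSemigroup.map _ u), hx, ← h, letters_map]
        simp [FreeMonoid.toList_map, toList_toMonoid]
      · refine absurd hx ?_
        rw [show FreeMonoid.ofList (a 0) = 1 from h, toList_toMonoid]
        simpa using letters_ne_nil _
    · exact Or.inr ⟨r, Nat.one_le_iff_ne_zero.2 hr, fun i => FreeMonoid.ofList (a i),
        fun j => (b j).1, fun j => e j + 1, ha, fun j => (b j).2, fun j => Nat.le_add_left _ _,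
        FreeMonoid.toList.injective hx⟩

end BasisWords

/-! ## Linear parts -/

section LinearPart

variable {k : Type u} {Y : Type v} [Field k]

theorem of_injective : Function.Injective (FreeSemigroup.of (α := Y)) :=
  fun _ _ h => congrArg FreeSemigroup.head h

theorem linearPart_apply (x : MonoidAlgebra k (FreeSemigroup Y)) (y : Y) :
    linearPart x y = x.coeff (FreeSemigroup.of y) := rfl

/-- The linear part, as a linear map. -/
def linearPartL (k : Type u) (Y : Type v) [Field k] :
    MonoidAlgebra k (FreeSemigroup Y) →ₗ[k] (Y →₀ k) where
  toFun := linearPart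
  map_add' x y := by ext z; rfl
  map_smul' c x := by ext z; rfl

theorem linearPartL_of (y : Y) :
    linearPartL k Y (MonoidAlgebra.single (FreeSemigroup.of y) 1) = Finsupp.single y 1 := by
  classical
  ext z
  change linearPart _ z = _
  simp [linearPart_apply, Finsupp.single_apply, of_injective.eq_iff]

theorem linearPartL_single_mul (a b : FreeSemigroup Y) :
    linearPartL k Y (MonoidAlgebra.single (a * b) 1) = 0 := by
  classical
  ext z
  have : a * b ≠ FreeSemigroup.of z := by
    intro h
    have := congrArg FreeSemigroup.length h
    rw [FreeSemigroup.length_mul, FreeSemigroup.length_of] at this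
    have ha : 0 < a.length := Nat.succ_pos _
    have hb : 0 < b.length := Nat.succ_pos _
    omega
  change linearPart _ z = _
  simp [linearPart_apply, this]

/-- Products contain only words of length at least two. This makes the `φ₄` identity blind to
whatever the operator does on linear parts. -/
theorem linearPartL_mul (x y : MonoidAlgebra k (FreeSemigroup Y)) :
    linearPartL k Y (x * y) = 0 := by
  have : (LinearMap.mul k (MonoidAlgebra k (FreeSemigroup Y))).compr₂ (linearPartL k Y) = 0 := by
    refine linearMap_ext_single fun a => linearMap_ext_single fun b => ?_
    simp [linearPartL_single_mul]
  exact LinearMap.congr_fun (LinearMap.congr_fun this x) y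

theorem linearPartL_alphabetHom {Z : Type w} (f : Z → Y)
    (x : MonoidAlgebra k (FreeSemigroup Z)) :
    linearPartL k Y (alphabetHom k f x) = Finsupp.mapDomain f (linearPartL k Z x) := by
  have : (linearPartL k Y).comp
      (alphabetHom k f : _ →ₗ[k] MonoidAlgebra k (FreeSemigroup Y)) =
      (Finsupp.lmapDomain k k f).comp (linearPartL k Z) := by
    refine linearMap_ext_single fun a => ?_
    change linearPartL k Y (alphabetHom k f _) = Finsupp.mapDomain f (linearPartL k Z _)
    induction a with
    | ih1 z =>
      rw [alphabetHom_single, FreeSemigroup.map_of, linearPartL_of, linearPartL_of,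
        Finsupp.mapDomain_single]
    | ih2 z a =>
      rw [alphabetHom_single, map_mul, linearPartL_single_mul, linearPartL_single_mul,
        Finsupp.mapDomain_zero]
  exact LinearMap.congr_fun this x

/-- Linear maps killing the ideal and prescribed multiples of products: if `T` kills the linear
parts of the generators, then `x ↦ λ x + T (linear part of x)` descends to the quotient. -/
theorem exists_phi4_operator (S : Set (MonoidAlgebra k (FreeSemigroup Y))) (lam : k)
    (T : (Y →₀ k) →ₗ[k] (AlgIdeal.span k S).Quot) (hT : ∀ s ∈ S, T (linearPartL k Y s) = 0) :
    ∃ D : (AlgIdeal.span k S).Quot →ₗ[k] (AlgIdeal.span k S).Quot, IsPhi4Algebra lam D ∧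
      ∀ x, D ((AlgIdeal.span k S).mkHom x) =
        lam • (AlgIdeal.span k S).mkHom x + T (linearPartL k Y x) := by
  let D₀ : MonoidAlgebra k (FreeSemigroup Y) →ₗ[k] (AlgIdeal.span k S).Quot :=
    lam • (AlgIdeal.span k S).mkL + T.comp (linearPartL k Y)
  -- The kernel of `T ∘ π` contains all products, so it is an ideal; containing `S`, it contains the
  -- ideal generated by `S`.
  let K : AlgIdeal k (MonoidAlgebra k (FreeSemigroup Y)) :=
    { LinearMap.ker (T.comp (linearPartL k Y)) with
      mul_mem_left' := fun a x _ => by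
        change T (linearPartL k Y (a * x)) = 0
        rw [linearPartL_mul, map_zero]
      mul_mem_right' := fun a x _ => by
        change T (linearPartL k Y (x * a)) = 0
        rw [linearPartL_mul, map_zero] }
  have hker : (AlgIdeal.span k S).toSubmodule ≤ LinearMap.ker D₀ := by
    intro x hx
    have h1 : T (linearPartL k Y x) = 0 := hx K hT
    have h2 : (AlgIdeal.span k S).mkHom x = 0 := (AlgIdeal.mkHom_eq_zero _).2 hx
    change lam • (AlgIdeal.span k S).mkHom x + T (linearPartL k Y x) = 0
    rw [h1, h2, smul_zero, add_zero]
  let D : (AlgIdeal.span k S).Quot →ₗ[k] (AlgIdeal.span k S).Quot :=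
    (AlgIdeal.span k S).toSubmodule.liftQ D₀ hker
  have hD : ∀ x, D ((AlgIdeal.span k S).mkHom x) =
      lam • (AlgIdeal.span k S).mkHom x + T (linearPartL k Y x) := fun x => rfl
  refine ⟨D, isPhi4Algebra_of_mul fun a b => ?_, hD⟩
  obtain ⟨a, rfl⟩ := (AlgIdeal.span k S).mkHom_surjective a
  obtain ⟨b, rfl⟩ := (AlgIdeal.span k S).mkHom_surjective b
  rw [← map_mul, hD, linearPartL_mul, map_zero, add_zero]

end LinearPart

/-! ## The model of the free `φ₄`-algebra -/

section Model

variable {k : Type u} {Z : Type v} [Field k]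

theorem alphabetHom_comp {Y : Type*} {Y' : Type*} (f : Z → Y) (g : Y → Y')
    (x : MonoidAlgebra k (FreeSemigroup Z)) :
    alphabetHom k g (alphabetHom k f x) = alphabetHom k (g ∘ f) x := by
  have : (alphabetHom k g).comp (alphabetHom k f) = alphabetHom k (g ∘ f) := by
    refine MonoidAlgebra.nonUnitalAlgHom_ext k fun w => ?_
    rw [NonUnitalAlgHom.comp_apply, alphabetHom_single, alphabetHom_single, alphabetHom_single]
    congr 1
    apply letters_injective
    rw [letters_map, letters_map, letters_map, List.map_map]
  exact DFunLike.congr_fun this x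

/-- The homomorphism sending the letters of the extended alphabet to the classes of the
bracketed words that they denote. -/
def extHom (lam : k) (I : AlgIdeal k (MonoidAlgebra k (FreeSemigroup Z))) (p : Z → Prop) :
    MonoidAlgebra k (FreeSemigroup (ExtLetter p)) →ₙₐ[k] FreePhi4 lam I :=
  (FreePhi4.mk lam I).comp (alphabetHom k ExtLetter.toOp)

variable (lam : k) (I : AlgIdeal k (MonoidAlgebra k (FreeSemigroup Z))) (p : Z → Prop)

theorem extHom_single (w : FreeSemigroup (ExtLetter p)) :
    extHom lam I p (MonoidAlgebra.single w 1) =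
      FreePhi4.ofWord lam I (FreeSemigroup.map ExtLetter.toOp w) :=
  congrArg (FreePhi4.mk lam I) (alphabetHom_single _ w 1)

theorem op_ofWord (w : OpWord Z) :
    FreePhi4.op lam I (FreePhi4.ofWord lam I w) = FreePhi4.ofWord lam I (OpWord.bracket w) :=
  (FreePhi4.op_mk lam I _).trans (congrArg (FreePhi4.mk lam I) (bracketL_single w))

theorem extHom_alphabetHom (x : MonoidAlgebra k (FreeSemigroup Z)) :
    extHom lam I p (alphabetHom k (ExtLetter.var p) x) = FreePhi4.mk lam I (inclHom k Z x) :=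
  congrArg (FreePhi4.mk lam I) (alphabetHom_comp (ExtLetter.var p) ExtLetter.toOp x)

theorem extHom_alphabetHom_eq_zero {x : MonoidAlgebra k (FreeSemigroup Z)}
    (hx : x ∈ I.toSubmodule) : extHom lam I p (alphabetHom k (ExtLetter.var p) x) = 0 := by
  rw [extHom_alphabetHom, ← FreePhi4.incl_mk, (AlgIdeal.mkHom_eq_zero I).2 hx, map_zero]

/-- The words in the extended alphabet span the free `φ₄`-algebra, as soon as the letters not
satisfying `p` can be eliminated modulo the linear parts of the elements of the ideal. -/
theorem extHom_surjective {W : Submodule k (Z →₀ k)}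
    (hW : W ≤ I.toSubmodule.map (linearPartL k Z))
    (hp : W ⊔ Finsupp.supported k k {z | p z} = ⊤) : Function.Surjective (extHom lam I p) := by
  let M : Submodule k (FreePhi4 lam I) :=
    LinearMap.range
    (extHom lam I p : MonoidAlgebra k (FreeSemigroup (ExtLetter p)) →ₗ[k] FreePhi4 lam I)
  have hM : ∀ x, extHom lam I p x ∈ M := fun x => ⟨x, rfl⟩
  let E : (Z →₀ k) →ₗ[k] FreePhi4 lam I :=
    Finsupp.linearCombination k fun z => FreePhi4.ofWord lam I (OpWord.ofVar z)
  have hE : ∀ z, E (Finsupp.single z 1) = FreePhi4.ofWord lam I (OpWord.ofVar z) := fun z => by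
    simp [E]
  -- Modulo `M` the operator sees only linear parts: a word of length at least two is a product, on
  -- which the operator is multiplication by `λ`.
  have hlin : ∀ x : MonoidAlgebra k (FreeSemigroup Z),
      FreePhi4.op lam I (FreePhi4.mk lam I (inclHom k Z x) - E (linearPartL k Z x)) ∈ M := by
    let L : MonoidAlgebra k (FreeSemigroup Z) →ₗ[k] FreePhi4 lam I :=
      (FreePhi4.op lam I).comp (((FreePhi4.mk lam I).comp (inclHom k Z) :
        MonoidAlgebra k (FreeSemigroup Z) →ₗ[k] FreePhi4 lam I) -
        E.comp (linearPartL k Z))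
    intro x
    change L x ∈ M
    rw [eq_sum_single x, Finsupp.sum, map_sum]
    refine Submodule.sum_mem _ fun w _ => ?_
    rw [map_smul]
    refine Submodule.smul_mem _ _ ?_
    change FreePhi4.op lam I (FreePhi4.mk lam I (inclHom k Z _) - E (linearPartL k Z _)) ∈ M
    induction w with
    | ih1 z =>
      rw [linearPartL_of, hE, inclHom_single]
      change FreePhi4.op lam I (FreePhi4.ofWord lam I _ - FreePhi4.ofWord lam I _) ∈ M
      rw [FreeSemigroup.map_of, OpWord.ofVar, sub_self, map_zero]
      exact M.zero_mem
    | ih2 z w =>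
      rw [linearPartL_single_mul, map_zero, sub_zero, ← mul_one (1 : k),
        ← MonoidAlgebra.single_mul_single, map_mul, map_mul,
        (FreePhi4.isPhi4Algebra lam I).op_mul, ← map_mul, ← map_mul, ← extHom_alphabetHom lam I p]
      exact M.smul_mem _ (hM _)
  -- For `f ∈ W` choose `x` in the ideal with linear part `f`; its class is `0`, so `hlin` leaves
  -- just the bracket of `f`. For `z` satisfying `p`, the bracket `⌊z⌋` is itself a letter of the
  -- extended alphabet.
  have hEM : ∀ f, FreePhi4.op lam I (E f) ∈ M := by
    have h : (⊤ : Submodule k (Z →₀ k)) ≤ M.comap ((FreePhi4.op lam I).comp E) := by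
      rw [← hp, sup_le_iff]
      constructor
      · intro f hf
        obtain ⟨x, hx, rfl⟩ := hW hf
        have := hlin x
        rw [← FreePhi4.incl_mk, (AlgIdeal.mkHom_eq_zero I).2 hx, map_zero, zero_sub, map_neg,
          Submodule.neg_mem_iff] at this
        exact this
      · rw [Finsupp.supported_eq_span_single, Submodule.span_le]
        rintro _ ⟨z, hz, rfl⟩
        change FreePhi4.op lam I (E _) ∈ M
        rw [hE, op_ofWord]
        exact ⟨MonoidAlgebra.single (FreeSemigroup.of (ExtLetter.power ⟨z, hz⟩ 0)) 1,
          extHom_single lam I p _⟩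
    exact fun f => h Submodule.mem_top
  -- Variables are covered by `hEM`, power letters pass to the next power, and products are
  -- multiplied by `λ`.
  have hop : ∀ x ∈ M, FreePhi4.op lam I x ∈ M := by
    rintro _ ⟨x, rfl⟩
    change ((FreePhi4.op lam I).comp (extHom lam I p :
      MonoidAlgebra k (FreeSemigroup (ExtLetter p)) →ₗ[k] FreePhi4 lam I)) x ∈ M
    rw [eq_sum_single x, Finsupp.sum, map_sum]
    refine Submodule.sum_mem _ fun w _ => ?_
    rw [map_smul]
    refine Submodule.smul_mem _ _ ?_
    change FreePhi4.op lam I (extHom lam I p _) ∈ M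
    induction w with
    | ih1 y =>
      rw [extHom_single, FreeSemigroup.map_of]
      induction y using ExtLetter.cases with
      | var z =>
        have := hEM (Finsupp.single z 1)
        rwa [hE] at this
      | power z n =>
        rw [op_ofWord, ExtLetter.toOp_power, bracket_of_powerLetter]
        exact ⟨MonoidAlgebra.single (FreeSemigroup.of (ExtLetter.power z (n + 1))) 1,
          extHom_single lam I p _⟩
    | ih2 y w =>
      rw [← mul_one (1 : k), ← MonoidAlgebra.single_mul_single, map_mul,
        (FreePhi4.isPhi4Algebra lam I).op_mul, ← map_mul]
      exact M.smul_mem _ (hM _)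
  have hword : ∀ w : OpWord Z, FreePhi4.ofWord lam I w ∈ M := by
    intro w
    induction w using OpWord.induction with
    | var z =>
      exact ⟨MonoidAlgebra.single (FreeSemigroup.of (ExtLetter.var p z)) 1,
        extHom_single lam I p _⟩
    | bracket w ih =>
      rw [← op_ofWord]
      exact hop _ ih
    | mul a b iha ihb =>
      obtain ⟨x, hx⟩ := iha
      obtain ⟨y, hy⟩ := ihb
      have : FreePhi4.ofWord lam I (a * b) =
          FreePhi4.ofWord lam I a * FreePhi4.ofWord lam I b := by
        change FreePhi4.mk lam I _ = FreePhi4.mk lam I _ * FreePhi4.mk lam I _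
        rw [← map_mul, MonoidAlgebra.single_mul_single, one_mul]
      rw [this, ← hx, ← hy]
      exact ⟨x * y, map_mul (extHom lam I p) x y⟩
  intro x
  obtain ⟨x, rfl⟩ := (freeIdeal lam I).toAlgIdeal.mkHom_surjective x
  change FreePhi4.mk lam I x ∈ M
  rw [eq_sum_single x, Finsupp.sum, map_sum]
  refine Submodule.sum_mem _ fun w _ => ?_
  rw [map_smul]
  exact M.smul_mem _ (hword w)

variable {G : Set (MonoidAlgebra k (FreeSemigroup Z))}

/-- The quotient of the free algebra on the extended alphabet by the ideal generated by `G`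
carries an operator for which the canonical map from the free `φ₄`-algebra inverts `extHom`. -/
theorem exists_retraction
    (ρ : (Z →₀ k) →ₗ[k] (Z →₀ k)) (hρG : ∀ g ∈ G, ρ (linearPartL k Z g) = 0)
    (hρp : ∀ z, p z → ρ (Finsupp.single z 1) = Finsupp.single z 1) :
    ∃ Φ : FreePhi4 lam (AlgIdeal.span k G) →ₙₐ[k]
        (AlgIdeal.span k (alphabetHom k (ExtLetter.var p) '' G)).Quot,
      ∀ x, Φ (extHom lam (AlgIdeal.span k G) p x) =
        (AlgIdeal.span k (alphabetHom k (ExtLetter.var p) '' G)).mkHom x := by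
  classical
  let J := AlgIdeal.span k (alphabetHom k (ExtLetter.var p) '' G)
  let cls : ExtLetter p → J.Quot := fun y =>
    J.mkHom (MonoidAlgebra.single (FreeSemigroup.of y) 1)
  -- The value `⌊z⌋ - λ z` is forced by `D z = λ z + T z = ⌊z⌋`. Applying `ρ` first makes `TZ` kill
  -- the linear parts of `G`. The value `0` off `p` plays no role: only the images of letters
  -- satisfying `p` and the vanishing on linear parts are used.
  let TZ : (Z →₀ k) →ₗ[k] J.Quot :=
    (Finsupp.linearCombination k fun z =>
      if h : p z then cls (ExtLetter.power ⟨z, h⟩ 0) - lam • cls (ExtLetter.var p z) else 0).comp ρ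
  have hTZ : ∀ z (h : p z), TZ (Finsupp.single z 1) =
      cls (ExtLetter.power ⟨z, h⟩ 0) - lam • cls (ExtLetter.var p z) := by
    intro z h
    change Finsupp.linearCombination k _ (ρ (Finsupp.single z 1)) = _
    rw [hρp z h, Finsupp.linearCombination_single, one_smul, dif_pos h]
  let t : ExtLetter p → J.Quot := fun y =>
    match ofLex y with
    | .inl z => TZ (Finsupp.single z 1)
    | .inr y => cls (ExtLetter.power (ofLex y).1 ((ofLex y).2 + 1)) -
        lam • cls (ExtLetter.power (ofLex y).1 (ofLex y).2)
  let T : (ExtLetter p →₀ k) →ₗ[k] J.Quot := Finsupp.linearCombination k t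
  have hTvar : ∀ f : Z →₀ k, T (Finsupp.mapDomain (ExtLetter.var p) f) = TZ f := by
    intro f
    have : T.comp (Finsupp.lmapDomain k k (ExtLetter.var p)) = TZ := by
      refine Finsupp.lhom_ext' fun z => LinearMap.ext_ring ?_
      change T (Finsupp.mapDomain _ (Finsupp.single z 1)) = TZ (Finsupp.single z 1)
      rw [Finsupp.mapDomain_single, Finsupp.linearCombination_single, one_smul]
      rfl
    exact LinearMap.congr_fun this f
  have hTpow : ∀ z n, T (Finsupp.single (ExtLetter.power z n) 1) =
      cls (ExtLetter.power z (n + 1)) - lam • cls (ExtLetter.power z n) := by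
    intro z n
    rw [Finsupp.linearCombination_single, one_smul]
    rfl
  obtain ⟨D, hD, hDmk⟩ := exists_phi4_operator (alphabetHom k (ExtLetter.var p) '' G) lam T (by
    rintro _ ⟨g, hg, rfl⟩
    rw [linearPartL_alphabetHom, hTvar]
    change Finsupp.linearCombination k _ (ρ _) = 0
    rw [hρG g hg, map_zero])
  have hDvar : ∀ z (h : p z), D (cls (ExtLetter.var p z)) = cls (ExtLetter.power ⟨z, h⟩ 0) := by
    intro z h
    refine (hDmk _).trans ?_
    rw [linearPartL_of, ← Finsupp.mapDomain_single (f := ExtLetter.var p), hTvar, hTZ z h]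
    exact add_sub_cancel _ _
  have hDpow : ∀ z n, D (cls (ExtLetter.power z n)) = cls (ExtLetter.power z (n + 1)) := by
    intro z n
    refine (hDmk _).trans ?_
    rw [linearPartL_of, hTpow]
    exact add_sub_cancel _ _
  -- The inclusion of alphabets carries `G` into `J`, hence descends to `A`; the universal property
  -- extends it to `Φ`.
  let f : (AlgIdeal.span k G).Quot →ₙₐ[k] J.Quot :=
    (AlgIdeal.span k G).liftHom (J.mkHom.comp (alphabetHom k (ExtLetter.var p))) fun x hx =>
      AlgIdeal.eq_zero_of_mem_span (h := J.mkHom.comp (alphabetHom k (ExtLetter.var p)))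
        (fun g hg => (AlgIdeal.mkHom_eq_zero J).2
          (AlgIdeal.subset_span (Set.mem_image_of_mem _ hg))) hx
  obtain ⟨Φ, ⟨hΦop, hΦf⟩, -⟩ :=
    (FreePhi4.isFreePhi4Over lam (AlgIdeal.span k G)).2 J.Quot D hD f
  have hΦvar : ∀ z, Φ (FreePhi4.ofWord lam _ (OpWord.ofVar z)) = cls (ExtLetter.var p z) := by
    intro z
    have h1 := hΦf ((AlgIdeal.span k G).mkHom (MonoidAlgebra.single (FreeSemigroup.of z) 1))
    rw [FreePhi4.incl_mk, inclHom_single] at h1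
    refine h1.trans ?_
    change J.mkHom (alphabetHom k _ _) = _
    rw [alphabetHom_single, FreeSemigroup.map_of]
  have hΦpow : ∀ z n, Φ (FreePhi4.ofWord lam _ (FreeSemigroup.of (powerLetter z.1 n))) =
      cls (ExtLetter.power z n) := by
    intro z n
    induction n with
    | zero =>
      exact (congrArg Φ (op_ofWord lam _ _).symm).trans
        ((hΦop _).trans ((congrArg D (hΦvar z.1)).trans (hDvar z.1 z.2)))
    | succ n ih => rw [← bracket_of_powerLetter, ← op_ofWord, hΦop, ih, hDpow]
  have hcomp : Φ.comp (extHom lam (AlgIdeal.span k G) p) = J.mkHom := by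
    refine MonoidAlgebra.nonUnitalAlgHom_ext k fun w => ?_
    rw [NonUnitalAlgHom.comp_apply]
    have hletter : ∀ y : ExtLetter p, Φ (extHom lam (AlgIdeal.span k G) p
        (MonoidAlgebra.single (FreeSemigroup.of y) 1)) =
        J.mkHom (MonoidAlgebra.single (FreeSemigroup.of y) 1) := by
      intro y
      rw [extHom_single, FreeSemigroup.map_of]
      induction y using ExtLetter.cases with
      | var z => exact hΦvar z
      | power z n => exact hΦpow z n
    induction w with
    | ih1 y => exact hletter y
    | ih2 y w hy hw =>
      rw [← mul_one (1 : k), ← MonoidAlgebra.single_mul_single, map_mul, map_mul, map_mul, hy, hw]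
  exact ⟨Φ, fun x => DFunLike.congr_fun hcomp x⟩

theorem linearPartSpan_le (G : Set (MonoidAlgebra k (FreeSemigroup Z))) :
    linearPartSpan G ≤ (AlgIdeal.span k G).toSubmodule.map (linearPartL k Z) := by
  refine Submodule.span_le.2 ?_
  rintro _ ⟨g, hg, rfl⟩
  exact ⟨g, AlgIdeal.subset_span hg, rfl⟩

end Model

-- Independence and spanning of the basis words

section Basis

variable {k : Type u} {Z : Type v} [Field k] [LinearOrder Z] [WellFoundedLT Z]
  {G : Set (MonoidAlgebra k (FreeSemigroup Z))} {G₁ : Set (Z →₀ k)}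

/-- The retraction `Φ` sends the class of a basis word to the class of an irreducible word over the
extended alphabet. Those are independent by the composition-diamond lemma, so their preimages are
too. -/
theorem linearIndependent_basisWords (hG : IsGSBasis G) (lam : k)
    (hG₁ : IsSelfReducedBasis (· < ·) G₁ (linearPartSpan G)) :
    LinearIndependent k
      fun w : basisWords G G₁ => FreePhi4.ofWord lam (AlgIdeal.span k G) w.1 := by
  obtain ⟨ρ, hρ1, hρ2, -, -⟩ := hG₁.1.exists_projection
  have hρG : ∀ g ∈ G, ρ (linearPartL k Z g) = 0 := by
    intro g hg
    have h : Submodule.span k G₁ ≤ LinearMap.ker ρ := Submodule.span_le.2 hρ1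
    rw [hG₁.2.2] at h
    exact h (Submodule.subset_span ⟨g, hg, rfl⟩)
  obtain ⟨Φ, hΦ⟩ := exists_retraction lam (fun z => ∀ g ∈ G₁, ¬ IsLeading (· < ·) g z) ρ hρG hρ2
  have hB := basisWords_eq_image G G₁
  have hex : ∀ w : basisWords G G₁, ∃ u ∈ Irr (alphabetHom k
      (ExtLetter.var fun z => ∀ g ∈ G₁, ¬ IsLeading (· < ·) g z) '' G),
      FreeSemigroup.map ExtLetter.toOp u = w.1 := fun w => hB.subset w.2
  choose u hu huw using hex
  have hinj : Function.Injective fun w => (⟨u w, hu w⟩ : Irr (alphabetHom k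
      (ExtLetter.var fun z => ∀ g ∈ G₁, ¬ IsLeading (· < ·) g z) '' G)) := by
    intro w w' h
    have h' : u w = u w' := congrArg Subtype.val h
    exact Subtype.ext (by rw [← huw w, ← huw w', h'])
  have hli := (hG.map (ExtLetter.var_strictMono
    (p := fun z => ∀ g ∈ G₁, ¬ IsLeading (· < ·) g z))).linearIndependent_irr.comp _ hinj
  refine LinearIndependent.of_comp (Φ : FreePhi4 lam (AlgIdeal.span k G) →ₗ[k]
    (AlgIdeal.span k (alphabetHom k
      (ExtLetter.var fun z => ∀ g ∈ G₁, ¬ IsLeading (· < ·) g z) '' G)).Quot) ?_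
  convert hli using 1
  funext w
  change Φ (FreePhi4.ofWord lam _ w.1) = _
  rw [← huw w, ← extHom_single, hΦ]
  rfl

/-- `extHom` is onto and kills the ideal generated by `G`, and the irreducible words span modulo
that ideal. -/
theorem span_basisWords (lam : k)
    (hG₁ : IsSelfReducedBasis (· < ·) G₁ (linearPartSpan G)) :
    Submodule.span k (Set.range
      fun w : basisWords G G₁ => FreePhi4.ofWord lam (AlgIdeal.span k G) w.1) = ⊤ := by
  obtain ⟨ρ, -, -, hρ3, hρ4⟩ := hG₁.1.exists_projection
  have hsurj : Function.Surjective (extHom lam (AlgIdeal.span k G)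
      fun z => ∀ g ∈ G₁, ¬ IsLeading (· < ·) g z) := by
    refine extHom_surjective lam _ _ (linearPartSpan_le G) ?_
    rw [eq_top_iff]
    intro f _
    rw [← sub_add_cancel f (ρ f)]
    refine Submodule.add_mem_sup ?_ ?_
    · rw [← hG₁.2.2]
      exact hρ4 f
    · exact (Finsupp.mem_supported k _).2 fun z hz => hρ3 f z (Finsupp.mem_support_iff.1 hz)
  rw [eq_top_iff]
  intro x _
  obtain ⟨x, rfl⟩ := hsurj x
  have hx : x ∈ (⊤ : Submodule k _) := Submodule.mem_top
  rw [← span_irr_sup_ideal (alphabetHom k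
    (ExtLetter.var fun z => ∀ g ∈ G₁, ¬ IsLeading (· < ·) g z) '' G)] at hx
  obtain ⟨y, hy, z, hz, rfl⟩ := Submodule.mem_sup.1 hx
  rw [map_add, AlgIdeal.eq_zero_of_mem_span (h := extHom lam (AlgIdeal.span k G) _) ?_ hz,
    add_zero]
  · refine (Submodule.span_le (p := (Submodule.span k _).comap
      (extHom lam (AlgIdeal.span k G) (fun z => ∀ g ∈ G₁, ¬ IsLeading (· < ·) g z) :
        MonoidAlgebra k (FreeSemigroup (ExtLetter _)) →ₗ[k]
          FreePhi4 lam (AlgIdeal.span k G)))).2 ?_ hy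
    rintro _ ⟨u, hu, rfl⟩
    refine Submodule.subset_span ⟨⟨FreeSemigroup.map ExtLetter.toOp u, ?_⟩,
      (extHom_single lam _ _ u).symm⟩
    rw [basisWords_eq_image]
    exact ⟨u, hu, rfl⟩
  · rintro _ ⟨g, hg, rfl⟩
    exact extHom_alphabetHom_eq_zero lam _ _ (AlgIdeal.subset_span hg)

end Basis

end

end PhiFour

theorem mainTheorem4 {k : Type u} [Field k]
    {Z : Type v} [LinearOrder Z] [WellFoundedLT Z]
    (G : Set (MonoidAlgebra k (FreeSemigroup Z))) (hfin : G.Finite) (hGS : IsGSBasis G)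
    (I : AlgIdeal k (MonoidAlgebra k (FreeSemigroup Z))) (hI : I = AlgIdeal.span k G)
    (lam : k) :
    (∃! G₁ : Set (Z →₀ k), IsSelfReducedBasis (· < ·) G₁ (linearPartSpan G)) ∧
    IsFreePhi4Over.{w} lam (FreePhi4.op lam I) (FreePhi4.incl lam I) ∧
    ∀ G₁ : Set (Z →₀ k), IsSelfReducedBasis (· < ·) G₁ (linearPartSpan G) →
      LinearIndependent k (fun w : basisWords G G₁ => FreePhi4.ofWord lam I w.1) ∧
      Submodule.span k (Set.range fun w : basisWords G G₁ => FreePhi4.ofWord lam I w.1) = ⊤ := by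
  subst hI
  refine ⟨existsUnique_isSelfReducedBasis _, FreePhi4.isFreePhi4Over lam _, fun G₁ hG₁ => ?_⟩
  exact ⟨linearIndependent_basisWords hGS lam hG₁, span_basisWords lam hG₁⟩
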